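/- An abstract simplicial complex $\Delta$ of dimension $d-1$ is \emph{balanced} if its vertices can be colored with $d$ colors so that no face contains two vertices of the same color. It is a \emph{simplicial manifold} if its geometric realization $\|\Delta\|$ is a $(d-1)$-dimensional topological manifold (without boundary), and it \emph{triangulates} a space $X$ if $\|\Delta\|$ is homeomorphic to $X$. The nonorientable $\mathbb{S}^{n}$-bundle over $\mathbb{S}^1$ ($n\ge 1$) is the quotient of $\mathbb{S}^{n}\times[0,1]$ by the identifications $(x,0)\sim(\rho(x),1)$, where $\rho$ is the reflection of $\mathbb{S}^n$ that changes the sign of the first coordinate. \textbf{Theorem.} For all $d\ge 3$ and $k\ge 2$ there exists a balanced simplicial manifold $\Delta_{k,d}$ of dimension $d-1$ with exactly $3d+k$ vertices that triangulates $\mathbb{S}^{d-2}\times\mathbb{S}^1$, and there exists a balanced simplicial manifold $\widetilde{\Delta}_{k,d}$ of dimension $d-1$ with exactly $3d+k$ vertices that triangulates the nonorientable $\mathbb{S}^{d-2}$-bundle over $\mathbb{S}^1$. -/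

import Mathlib

/-- The geometric realization `‖K‖` of a finite abstract simplicial complex, in barycentric
coordinates: the points of the standard simplex on the vertex set whose support lies in a face,
with the subspace topology from `V → ℝ`. -/
def AbstractSimplicialComplex.realization {V : Type*} [Fintype V]
    (K : AbstractSimplicialComplex V) : Set (V → ℝ) :=
  {x | x ∈ stdSimplex ℝ V ∧ ∃ s ∈ K.faces, ∀ v, v ∉ s → x v = 0}

/-- `K` has dimension `n`: some face has `n + 1` vertices, and no face has more. -/
def AbstractSimplicialComplex.HasDim {V : Type*} (K : AbstractSimplicialComplex V) (n : ℕ) :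
    Prop :=
  (∃ s ∈ K.faces, s.card = n + 1) ∧ ∀ s ∈ K.faces, s.card ≤ n + 1

/-- `K` is an `n`-dimensional balanced complex: it has dimension `n`, and its vertices can be
coloured with `n + 1` colours so that no face contains two vertices of the same colour. -/
def AbstractSimplicialComplex.IsBalanced {V : Type*} (K : AbstractSimplicialComplex V) (n : ℕ) :
    Prop :=
  K.HasDim n ∧ ∃ κ : V → Fin (n + 1), ∀ s ∈ K.faces, Set.InjOn κ (s : Set V)

/-- A topological `n`-manifold without boundary: Hausdorff, second countable, and locally
homeomorphic to Euclidean `n`-space. -/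
def IsTopManifold (n : ℕ) (X : Type*) [TopologicalSpace X] : Prop :=
  T2Space X ∧ SecondCountableTopology X ∧
    ∀ x : X, ∃ e : OpenPartialHomeomorph X (EuclideanSpace ℝ (Fin n)), x ∈ e.source

/-- `K` is a simplicial `n`-manifold: an `n`-dimensional complex whose geometric realization is
an `n`-manifold. -/
def AbstractSimplicialComplex.IsSimplicialManifold {V : Type*} [Fintype V]
    (K : AbstractSimplicialComplex V) (n : ℕ) : Prop :=
  K.HasDim n ∧ IsTopManifold n K.realization

/-- `K` triangulates the space `X`: its geometric realization is homeomorphic to `X`. -/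
def AbstractSimplicialComplex.Triangulates {V : Type*} [Fintype V]
    (K : AbstractSimplicialComplex V) (X : Type*) [TopologicalSpace X] : Prop :=
  Nonempty (K.realization ≃ₜ X)

/-- The unit sphere `𝕊ⁿ` in Euclidean `(n + 1)`-space. -/
abbrev UnitSphere (n : ℕ) : Type :=
  Metric.sphere (0 : EuclideanSpace ℝ (Fin (n + 1))) 1

/-- The reflection of `𝕊ⁿ` that changes the sign of the first coordinate. -/
noncomputable def sphereReflection (n : ℕ) (x : UnitSphere n) : UnitSphere n :=
  ⟨WithLp.toLp 2 fun i => if i = 0 then -(x.1 i) else x.1 i, by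
    have hx : ‖x.1‖ = 1 := mem_sphere_zero_iff_norm.mp x.2
    refine mem_sphere_zero_iff_norm.mpr (Eq.trans ?_ hx)
    rw [EuclideanSpace.norm_eq, EuclideanSpace.norm_eq]
    congr 1
    refine Finset.sum_congr rfl fun i _ => ?_
    by_cases h : i = 0 <;> simp [h]⟩

/-- The mapping torus of `f : X → X`: the quotient of `X × [0, 1]` by the identifications
`(x, 0) ∼ (f x, 1)`, with the quotient topology. For a homeomorphism `f` it is the total space
of the bundle over `𝕊¹ = [0, 1] / (0 ∼ 1)` with fibre `X` and monodromy `f`. -/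
abbrev MappingTorus {X : Type*} (f : X → X) : Type _ :=
  Quot fun p q : X × unitInterval => p.2 = 0 ∧ q.2 = 1 ∧ q.1 = f p.1

/-- The nonorientable `𝕊ⁿ`-bundle over `𝕊¹` (for `n ≥ 1`): the bundle whose monodromy is a
reflection of `𝕊ⁿ`. -/
abbrev NonorientableSphereBundle (n : ℕ) : Type :=
  MappingTorus (sphereReflection n)

/-! Remove two opposite facets from the boundary of a `d`-dimensional cross-polytope: what remains
is a triangulated cylinder over `𝕊^(d-2)`. Three such cylinders glued end to end in a circle give a
complex on `3d` vertices, `crossTorus σ`, where `σ` permutes the labels at the last gluing. Crossing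
a cylinder replaces every vertex by its antipode, so it acts on the level spheres as the antipodal
map; three crossings amount to one antipode. By `nonempty_homeomorph_crossTorus` the polyhedron is
therefore the mapping torus of the antipode followed by `σ`.

An isotopy of the monodromy does not change the mapping torus. Half turns in coordinate planes
deform the antipode of `𝕊ⁿ` into `ρ^(n+1)`, with `ρ` the reflection, and a transposition `σ`
contributes one more `ρ` (`nonempty_homeomorph_crossTorus_iterate`). According to the parity of `d`,
the choices `σ = 1` and `σ = swap 0 1` thus give the trivial and the nonorientable bundle in one
order or the other. The manifold property is read off from charts of the mapping torus and
transported along the homeomorphism.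

It remains to colour and to add vertices, using bistellar moves, which are explicit homeomorphisms
of polyhedra (`nonempty_homeomorph_bistellar`). For `σ = 1` the index of a vertex is already a
proper colour; replacing an edge `uv` by a path `u b a v` with alternating colours adds two
vertices. For the transposition exactly two edges are monochromatic, and subdividing each by a
vertex of the other's colour repairs the colouring (`IsTwistedRainbow.isRainbow`). Both routes reach
`3d + 2` vertices and leave an alternating path `p q r s` in the link of some `w`. Subdividing edges
adds two vertices at a time and recreates such a path. For the other parity, the disc `w * pqrs` is
finally retriangulated with one inner vertex coloured like `w`
(`HasAlternatingPath.isRainbow_pathMove`). -/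

open Topology

set_option linter.unusedSectionVars false

/-! ### Mapping tori: recognition, change of monodromy, charts -/

section MappingTorus

variable {X Y : Type*} [TopologicalSpace X] [TopologicalSpace Y]

/-- Conjugate homeomorphisms have homeomorphic mapping tori. -/
def MappingTorus.conj (e : X ≃ₜ Y) {f : X → X} {g : Y → Y} (h : ∀ x, e (f x) = g (e x)) :
    MappingTorus f ≃ₜ MappingTorus g :=
  Homeomorph.Quot.congr (e.prodCongr (Homeomorph.refl _)) fun p q => by
    simp [← h]

/-- Composing the monodromy with the end of an isotopy that starts at the identity does not
change the mapping torus. -/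
def MappingTorus.isotopy (P Q : unitInterval → X → X)
    (hP : Continuous fun p : X × unitInterval => P p.2 p.1)
    (hQ : Continuous fun p : X × unitInterval => Q p.2 p.1)
    (hPQ : ∀ t x, P t (Q t x) = x) (hQP : ∀ t x, Q t (P t x) = x)
    (h0 : ∀ x, P 0 x = x) (f : X → X) :
    MappingTorus f ≃ₜ MappingTorus (fun x => P 1 (f x)) :=
  Homeomorph.Quot.congr
    { toFun := fun p => (P p.2 p.1, p.2)
      invFun := fun p => (Q p.2 p.1, p.2)
      left_inv := fun p => by simp [hQP]
      right_inv := fun p => by simp [hPQ]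
      continuous_toFun := hP.prodMk continuous_snd
      continuous_invFun := hQ.prodMk continuous_snd : X × unitInterval ≃ₜ X × unitInterval}
    fun p q => by
      have inj : Function.Injective (P 1) := Function.LeftInverse.injective (hQP 1)
      constructor
      · rintro ⟨h1, h2, h3⟩
        exact ⟨h1, h2, by simp [h1, h2, h3, h0]⟩
      · rintro ⟨h1, h2, h3⟩
        replace h1 : p.2 = 0 := h1
        replace h2 : q.2 = 1 := h2
        replace h3 : P q.2 q.1 = P 1 (f (P p.2 p.1)) := h3
        rw [h1, h2, h0] at h3
        exact ⟨h1, h2, inj h3⟩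

theorem MappingTorus.nonempty_homeomorph [CompactSpace X] [T2Space Y] {φ : X → X}
    (f : X × unitInterval → Y) (hf : Continuous f) (hs : Function.Surjective f)
    (h0 : ∀ x, f (x, 0) = f (φ x, 1))
    (hinj : ∀ p q : X × unitInterval, p.2 ≤ q.2 → f p = f q →
      p = q ∨ (p.2 = 0 ∧ q.2 = 1 ∧ q.1 = φ p.1)) :
    Nonempty (MappingTorus φ ≃ₜ Y) := by
  let F : MappingTorus φ → Y := Quot.lift f (by
    rintro ⟨x, s⟩ ⟨y, t⟩ ⟨h1, h2, h3⟩
    simp only at h1 h2 h3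
    subst h1 h2 h3
    exact h0 x)
  have hF : Continuous F := continuous_quot_lift _ hf
  have key : ∀ p q : X × unitInterval, p.2 ≤ q.2 → f p = f q →
      (Quot.mk _ p : MappingTorus φ) = Quot.mk _ q := by
    intro p q hpq h
    rcases hinj p q hpq h with rfl | h
    · rfl
    · exact Quot.sound h
  have hb : Function.Bijective F := by
    constructor
    · rintro ⟨p⟩ ⟨q⟩ h
      rcases le_total p.2 q.2 with hpq | hpq
      · exact key p q hpq h
      · exact (key q p hpq h.symm).symm
    · intro y
      obtain ⟨p, rfl⟩ := hs y
      exact ⟨Quot.mk _ p, rfl⟩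
  exact ⟨Continuous.homeoOfEquivCompactToT2 (f := Equiv.ofBijective F hb) hF⟩

theorem MappingTorus.nonempty_homeomorph_prod_circle [CompactSpace X] [T2Space X] :
    Nonempty (MappingTorus (id : X → X) ≃ₜ X × Circle) := by
  refine MappingTorus.nonempty_homeomorph
    (fun p => (p.1, Circle.exp (2 * Real.pi * p.2))) (by fun_prop) ?_ ?_ ?_
  · rintro ⟨x, z⟩
    obtain ⟨θ, hθ⟩ : ∃ θ : ℝ, Circle.exp θ = z := ⟨_, Circle.exp_arg z⟩
    have hpi := Real.pi_pos
    refine ⟨(x, ⟨Int.fract (θ / (2 * Real.pi)), Int.fract_nonneg _, (Int.fract_lt_one _).le⟩), ?_⟩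
    simp only [Prod.mk.injEq, true_and]
    rw [← hθ, Circle.exp_eq_exp]
    refine ⟨-⌊θ / (2 * Real.pi)⌋, ?_⟩
    rw [Int.fract]
    push_cast
    field_simp
    ring
  · intro x
    simp
  · rintro ⟨x, s⟩ ⟨y, t⟩ hst h
    simp only [Prod.mk.injEq] at h ⊢
    obtain ⟨rfl, h⟩ := h
    rw [Circle.exp_eq_exp] at h
    obtain ⟨m, hm⟩ := h
    have hpi := Real.pi_pos
    have hm' : (s : ℝ) = t + m := by
      have : 2 * Real.pi * (s - t - m) = 0 := by linarith
      rcases mul_eq_zero.mp this with h | h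
      · linarith
      · linarith
    have hst' : (s : ℝ) ≤ t := hst
    have h1 : (m : ℝ) ≤ 0 := by linarith
    have h2 : (-1 : ℝ) ≤ m := by linarith [s.2.1, t.2.2]
    have h1' : m ≤ 0 := by exact_mod_cast h1
    have h2' : -1 ≤ m := by exact_mod_cast h2
    have : m = 0 ∨ m = -1 := by omega
    rcases this with rfl | rfl
    · left
      refine ⟨rfl, Subtype.ext ?_⟩
      simpa using hm'
    · right
      push_cast at hm'
      refine ⟨Subtype.ext ?_, Subtype.ext ?_, rfl⟩
      · simp only [Set.Icc.coe_zero]; linarith [s.2.1, t.2.2]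
      · simp only [Set.Icc.coe_one]; linarith [s.2.1, t.2.2]

/-- The part of the mapping torus away from the seam. -/
def MappingTorus.interiorMap (φ : X → X) (p : X × Set.Ioo (0 : ℝ) 1) : MappingTorus φ :=
  Quot.mk _ (p.1, ⟨p.2, p.2.2.1.le, p.2.2.2.le⟩)

/-- The three alternatives already form an equivalence relation: chains of two identifications
either collapse by injectivity of `φ` or would need `0 = 1`. -/
theorem MappingTorus.mk_eq_mk {X : Type*} {φ : X → X} (hφ : Function.Injective φ)
    {p q : X × unitInterval}
    (h : (Quot.mk _ p : MappingTorus φ) = Quot.mk _ q) :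
    p = q ∨ (p.2 = 0 ∧ q.2 = 1 ∧ q.1 = φ p.1) ∨ (q.2 = 0 ∧ p.2 = 1 ∧ p.1 = φ q.1) := by
  rw [Quot.eq] at h
  induction h with
  | rel x y h => exact Or.inr (Or.inl h)
  | refl x => exact Or.inl rfl
  | symm x y _ ih => rcases ih with h | h | h <;> simp [h]
  | trans x y z _ _ ih1 ih2 =>
    have h01 : (0 : unitInterval) ≠ 1 := zero_ne_one
    rcases ih1 with rfl | ⟨a1, a2, a3⟩ | ⟨a1, a2, a3⟩
    · exact ih2
    · rcases ih2 with rfl | ⟨b1, b2, b3⟩ | ⟨b1, b2, b3⟩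
      · exact Or.inr (Or.inl ⟨a1, a2, a3⟩)
      · exact absurd (b1.symm.trans a2) h01
      · left
        exact Prod.ext (hφ (a3.symm.trans b3)) (a1.trans b1.symm)
    · rcases ih2 with rfl | ⟨b1, b2, b3⟩ | ⟨b1, b2, b3⟩
      · exact Or.inr (Or.inr ⟨a1, a2, a3⟩)
      · left
        exact Prod.ext (a3.trans b3.symm) (a2.trans b2.symm)
      · exact absurd (a1.symm.trans b2) h01

theorem MappingTorus.isOpenEmbedding_interiorMap {φ : X → X} (hφ : Function.Injective φ) :
    IsOpenEmbedding (MappingTorus.interiorMap φ) := by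
  refine IsOpenEmbedding.of_continuous_injective_isOpenMap ?_ ?_ ?_
  · refine continuous_quot_mk.comp ?_
    exact continuous_fst.prodMk (Continuous.subtype_mk (by fun_prop) _)
  · rintro ⟨x, s, hs⟩ ⟨y, t, ht⟩ h
    rcases MappingTorus.mk_eq_mk hφ h with h | ⟨h, -⟩ | ⟨h, -⟩
    · simpa [Subtype.ext_iff] using h
    · exact absurd (congrArg Subtype.val h) hs.1.ne'
    · exact absurd (congrArg Subtype.val h) ht.1.ne'
  · intro U hU
    rw [← isQuotientMap_quot_mk.isOpen_preimage]
    have hop : IsOpenEmbedding (fun p : X × Set.Ioo (0 : ℝ) 1 =>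
        ((p.1, ⟨p.2, p.2.2.1.le, p.2.2.2.le⟩) : X × unitInterval)) := by
      refine IsOpenEmbedding.prodMap (f := id) (g := fun p : Set.Ioo (0 : ℝ) 1 =>
        (⟨p, p.2.1.le, p.2.2.le⟩ : unitInterval)) IsOpenEmbedding.id ?_
      refine ⟨(IsEmbedding.inclusion Set.Ioo_subset_Icc_self), ?_⟩
      have : Set.range (fun p : Set.Ioo (0 : ℝ) 1 =>
          (⟨p, p.2.1.le, p.2.2.le⟩ : unitInterval)) = Subtype.val ⁻¹' (Set.Ioo (0 : ℝ) 1) := by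
        ext ⟨t, ht⟩
        simp [Subtype.ext_iff]
      rw [this]
      exact isOpen_Ioo.preimage continuous_subtype_val
    convert hop.isOpenMap U hU using 1
    ext ⟨x, t⟩
    constructor
    · rintro ⟨p, hp, h⟩
      rcases MappingTorus.mk_eq_mk hφ h with h | ⟨h, -⟩ | ⟨-, h, -⟩
      · exact ⟨p, hp, h⟩
      · exact absurd (congrArg Subtype.val h) p.2.2.1.ne'
      · exact absurd (congrArg Subtype.val h) p.2.2.2.ne
    · rintro ⟨p, hp, h⟩
      exact ⟨p, hp, congrArg (Quot.mk _) h⟩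

/-- A neighbourhood of the seam of the mapping torus. -/
noncomputable def MappingTorus.seamMap (φ : X ≃ₜ X) (p : X × Set.Ioo (-(1 / 2) : ℝ) (1 / 2)) :
    MappingTorus φ :=
  if h : 0 ≤ (p.2 : ℝ) then
    Quot.mk _ (p.1, ⟨p.2, h, by linarith [p.2.2.2]⟩)
  else Quot.mk _ (φ p.1, ⟨p.2 + 1, by linarith [p.2.2.1], by linarith [not_le.mp h]⟩)

theorem MappingTorus.continuous_seamMap (φ : X ≃ₜ X) :
    Continuous (MappingTorus.seamMap φ) := by
  have h1 : Continuous fun p : X × Set.Ioo (-(1 / 2) : ℝ) (1 / 2) =>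
      (Quot.mk _ (p.1, Set.projIcc (0 : ℝ) 1 zero_le_one p.2) : MappingTorus φ) :=
    continuous_quot_mk.comp (continuous_fst.prodMk (continuous_projIcc.comp (by fun_prop)))
  have h2 : Continuous fun p : X × Set.Ioo (-(1 / 2) : ℝ) (1 / 2) =>
      (Quot.mk _ (φ p.1, Set.projIcc (0 : ℝ) 1 zero_le_one (p.2 + 1)) : MappingTorus φ) :=
    continuous_quot_mk.comp ((φ.continuous.comp continuous_fst).prodMk
      (continuous_projIcc.comp (by fun_prop)))
  have h3 : MappingTorus.seamMap φ = fun p => if 0 ≤ (p.2 : ℝ) then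
      (Quot.mk _ (p.1, Set.projIcc (0 : ℝ) 1 zero_le_one p.2) : MappingTorus φ)
      else Quot.mk _ (φ p.1, Set.projIcc (0 : ℝ) 1 zero_le_one (p.2 + 1)) := by
    funext ⟨x, s, hs1, hs2⟩
    unfold MappingTorus.seamMap
    by_cases h : 0 ≤ s
    · have : s ∈ Set.Icc (0 : ℝ) 1 := ⟨h, by linarith⟩
      simp [h, Set.projIcc_of_mem _ this]
    · have : s + 1 ∈ Set.Icc (0 : ℝ) 1 := ⟨by linarith, by linarith⟩
      simp [h, Set.projIcc_of_mem _ this]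
  rw [h3]
  refine Continuous.if_le h1 h2 continuous_const (by fun_prop) ?_
  rintro ⟨x, s, hs⟩ h
  simp only at h
  subst h
  refine Quot.sound ⟨?_, ?_, rfl⟩ <;> simp

/-- Describes the saturated preimage of the image of `U` in `X × [0, 1]`, where openness is tested.
Height `1 / 2` is the only one that the seam chart misses. -/
theorem MappingTorus.mk_mem_image_seamMap {φ : X ≃ₜ X}
    {U : Set (X × Set.Ioo (-(1 / 2) : ℝ) (1 / 2))} {x : X} {t : unitInterval} :
    (Quot.mk _ (x, t) : MappingTorus φ) ∈ MappingTorus.seamMap φ '' U ↔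
      (∃ h : (t : ℝ) < 1 / 2, (x, ⟨t, by linarith [t.2.1], h⟩) ∈ U) ∨
      (∃ h : 1 / 2 < (t : ℝ), (φ.symm x, ⟨t - 1, by linarith, by linarith [t.2.2]⟩) ∈ U) := by
  constructor
  · rintro ⟨⟨y, s, hs⟩, hp, h⟩
    unfold MappingTorus.seamMap at h
    have inj := φ.injective
    split_ifs at h with h0
    · simp only at h0
      rcases MappingTorus.mk_eq_mk inj h with h | ⟨h1, h2, h3⟩ | ⟨h1, h2, h3⟩
      · simp only [Prod.mk.injEq] at h
        obtain ⟨rfl, rfl⟩ := h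
        exact Or.inl ⟨hs.2, hp⟩
      · simp only at h1 h2 h3
        subst h2 h3
        right
        have h1 : s = 0 := congrArg Subtype.val h1
        subst h1
        refine ⟨by norm_num, ?_⟩
        simpa using hp
      · have h2 : s = 1 := congrArg Subtype.val h2
        linarith [hs.2]
    · simp only [not_le] at h0
      rcases MappingTorus.mk_eq_mk inj h with h | ⟨h1, h2, h3⟩ | ⟨h1, h2, h3⟩
      · simp only [Prod.mk.injEq] at h
        obtain ⟨rfl, rfl⟩ := h
        right
        refine ⟨by simp only; linarith [hs.1], ?_⟩
        simpa using hp
      · have h1 : s + 1 = 0 := congrArg Subtype.val h1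
        linarith [hs.1]
      · have h2 : s + 1 = 1 := congrArg Subtype.val h2
        linarith
  · rintro (⟨h, hU⟩ | ⟨h, hU⟩)
    · refine ⟨_, hU, ?_⟩
      unfold MappingTorus.seamMap
      simp [t.2.1]
    · refine ⟨_, hU, ?_⟩
      unfold MappingTorus.seamMap
      split_ifs with h0
      · simp only at h0
        have : t = 1 := Subtype.ext (le_antisymm t.2.2 (by simpa using h0))
        subst this
        exact Quot.sound ⟨by simp, rfl, by simp⟩
      · congr 1
        simp

theorem MappingTorus.isOpenEmbedding_seamMap (φ : X ≃ₜ X) :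
    IsOpenEmbedding (MappingTorus.seamMap φ) := by
  refine IsOpenEmbedding.of_continuous_injective_isOpenMap
    (MappingTorus.continuous_seamMap φ) ?_ ?_
  · rintro ⟨x, s, hs⟩ ⟨y, t, ht⟩ h
    unfold MappingTorus.seamMap at h
    split_ifs at h with h0 h1 h1 <;>
      have h' := MappingTorus.mk_eq_mk φ.injective h <;> clear h <;>
      rcases h' with h | ⟨a, b, c⟩ | ⟨a, b, c⟩ <;>
      simp only [Prod.mk.injEq, Subtype.ext_iff, Set.Icc.coe_zero,
        Set.Icc.coe_one] at * <;>
      obtain ⟨hs1, hs2⟩ := hs <;> obtain ⟨ht1, ht2⟩ := ht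
    · exact h
    · linarith
    · linarith
    · linarith [h.2]
    · linarith
    · linarith
    · linarith [h.2]
    · linarith
    · linarith
    · exact ⟨φ.injective h.1, by linarith [h.2]⟩
    · linarith
    · linarith
  · intro U hU
    rw [← isQuotientMap_quot_mk.isOpen_preimage]
    have e1 : IsOpen {p : X × unitInterval | ∃ h : (p.2 : ℝ) < 1 / 2,
        (p.1, (⟨p.2, by linarith [p.2.2.1], h⟩ : Set.Ioo (-(1 / 2) : ℝ) (1 / 2))) ∈ U} := by
      obtain ⟨W, hW, rfl⟩ : ∃ W : Set (X × ℝ), IsOpen W ∧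
          (Prod.map id Subtype.val) ⁻¹' W = U :=
        (IsInducing.prodMap IsInducing.id IsInducing.subtypeVal).isOpen_iff.mp hU
      have : IsOpen ({p : X × unitInterval | (p.2 : ℝ) < 1 / 2} ∩
          (fun p : X × unitInterval => (p.1, (p.2 : ℝ))) ⁻¹' W) :=
        (isOpen_lt (by fun_prop) continuous_const).inter (hW.preimage (by fun_prop))
      convert this using 1
      ext ⟨x, t⟩
      simp
    have e2 : IsOpen {p : X × unitInterval | ∃ h : 1 / 2 < (p.2 : ℝ),
        (φ.symm p.1, (⟨p.2 - 1, by linarith, by linarith [p.2.2.2]⟩ :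
          Set.Ioo (-(1 / 2) : ℝ) (1 / 2))) ∈ U} := by
      obtain ⟨W, hW, rfl⟩ : ∃ W : Set (X × ℝ), IsOpen W ∧
          (Prod.map id Subtype.val) ⁻¹' W = U :=
        (IsInducing.prodMap IsInducing.id IsInducing.subtypeVal).isOpen_iff.mp hU
      have : IsOpen ({p : X × unitInterval | 1 / 2 < (p.2 : ℝ)} ∩
          (fun p : X × unitInterval => (φ.symm p.1, (p.2 : ℝ) - 1)) ⁻¹' W) :=
        (isOpen_lt continuous_const (by fun_prop)).inter (hW.preimage (by fun_prop))
      convert this using 1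
      ext ⟨x, t⟩
      simp
    convert e1.union e2 using 1
    ext ⟨x, t⟩
    exact MappingTorus.mk_mem_image_seamMap

end MappingTorus

/-! ### Locally Euclidean spaces -/

/-- Every point has an open neighbourhood homeomorphic to an open subset of Euclidean `n`-space. -/
def IsLocallyEuclidean (n : ℕ) (X : Type*) [TopologicalSpace X] : Prop :=
  ∀ x : X, ∃ e : OpenPartialHomeomorph X (EuclideanSpace ℝ (Fin n)), x ∈ e.source

theorem IsLocallyEuclidean.prod_real {n : ℕ} {X : Type*} [TopologicalSpace X]
    (h : IsLocallyEuclidean n X) : IsLocallyEuclidean (n + 1) (X × ℝ) := by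
  rintro ⟨x, t⟩
  obtain ⟨e, he⟩ := h x
  have L : (EuclideanSpace ℝ (Fin n) × ℝ) ≃L[ℝ] EuclideanSpace ℝ (Fin (n + 1)) :=
    ContinuousLinearEquiv.ofFinrankEq (by simp)
  refine ⟨(e.prod (OpenPartialHomeomorph.refl ℝ)).trans
    L.toHomeomorph.toOpenPartialHomeomorph, ?_⟩
  simp [he]

theorem IsLocallyEuclidean.of_openEmbeddings {n : ℕ} {X : Type*} [TopologicalSpace X]
    (h : ∀ x : X, ∃ (Z : Type) (_ : TopologicalSpace Z) (f : Z → X), IsOpenEmbedding f ∧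
      x ∈ Set.range f ∧ IsLocallyEuclidean n Z) : IsLocallyEuclidean n X := by
  intro x
  obtain ⟨Z, _, f, hf, ⟨z, rfl⟩, hZ⟩ := h x
  obtain ⟨e, he⟩ := hZ z
  have : Nonempty Z := ⟨z⟩
  refine ⟨(hf.toOpenPartialHomeomorph f).symm.trans e, ?_⟩
  simp [he, hf.toOpenPartialHomeomorph_left_inv]

theorem IsLocallyEuclidean.of_isOpenEmbedding {n : ℕ} {X Z : Type*} [TopologicalSpace X]
    [TopologicalSpace Z] (hX : IsLocallyEuclidean n X) (f : Z → X) (hf : IsOpenEmbedding f) :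
    IsLocallyEuclidean n Z := by
  intro z
  obtain ⟨e, he⟩ := hX (f z)
  have : Nonempty Z := ⟨z⟩
  refine ⟨(hf.toOpenPartialHomeomorph f).trans e, ?_⟩
  simp [he]

theorem isLocallyEuclidean_mappingTorus {n : ℕ} {X : Type} [TopologicalSpace X]
    (hX : IsLocallyEuclidean n X) (φ : X ≃ₜ X) :
    IsLocallyEuclidean (n + 1) (MappingTorus φ) := by
  have key : ∀ a b : ℝ, IsLocallyEuclidean (n + 1) (X × Set.Ioo a b) := fun a b =>
    hX.prod_real.of_isOpenEmbedding (Prod.map id Subtype.val)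
      (IsOpenEmbedding.id.prodMap isOpen_Ioo.isOpenEmbedding_subtypeVal)
  refine IsLocallyEuclidean.of_openEmbeddings ?_
  rintro ⟨x, t⟩
  -- The interior chart covers height `1 / 2`; the seam chart covers every other height.
  by_cases ht : (t : ℝ) = 1 / 2
  · refine ⟨_, _, _, MappingTorus.isOpenEmbedding_interiorMap φ.injective,
      ⟨(x, ⟨t, by rw [ht]; norm_num, by rw [ht]; norm_num⟩), rfl⟩, key _ _⟩
  · refine ⟨_, _, _, MappingTorus.isOpenEmbedding_seamMap φ, ?_, key _ _⟩
    rw [← Set.image_univ]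
    refine MappingTorus.mk_mem_image_seamMap.mpr ?_
    rcases lt_or_gt_of_ne ht with h | h
    · exact Or.inl ⟨h, trivial⟩
    · exact Or.inr ⟨h, trivial⟩

theorem isLocallyEuclidean_unitSphere (n : ℕ) : IsLocallyEuclidean n (UnitSphere n) := by
  intro x
  have : Fact (Module.finrank ℝ (EuclideanSpace ℝ (Fin (n + 1))) = n + 1) := ⟨by simp⟩
  exact ⟨chartAt (EuclideanSpace ℝ (Fin n)) x, mem_chart_source _ x⟩

/-! ### Bistellar moves as homeomorphisms of polyhedra -/

section Realization

variable {V : Type*} [Fintype V]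

/-- The points of the standard simplex supported on a member of the family `K`. -/
def polyhedron (K : Set (Finset V)) : Set (V → ℝ) :=
  {x | x ∈ stdSimplex ℝ V ∧ ∃ s ∈ K, ∀ v, v ∉ s → x v = 0}

variable [DecidableEq V]

/-- The map underlying a bistellar move: the largest multiple of the barycentre of `A` below `x`
is moved to the barycentre of `B`. -/
noncomputable def moveMass (A B : Finset V) (hA : A.Nonempty) (x : V → ℝ) (v : V) : ℝ :=
  x v - (if v ∈ A then A.inf' hA x else 0) +
    (if v ∈ B then (A.card / B.card : ℝ) * A.inf' hA x else 0)

theorem continuous_moveMass (A B : Finset V) (hA : A.Nonempty) :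
    Continuous (moveMass A B hA) := by
  have h : Continuous fun x : V → ℝ => A.inf' hA x :=
    Continuous.finset_inf'_apply hA fun i _ => continuous_apply i
  refine continuous_pi fun v => ?_
  unfold moveMass
  refine ((continuous_apply v).sub ?_).add ?_
  · split_ifs
    · exact h
    · exact continuous_const
  · split_ifs
    · exact continuous_const.mul h
    · exact continuous_const

/-- One half of the relation between two complexes that differ by a bistellar move replacing the
face `A` by the face `B`. -/
structure IsBistellarHalf (K L : Set (Finset V)) (A B : Finset V) : Prop where
  not_subset : ∀ s ∈ K, ¬ B ⊆ s
  mem : ∀ s ∈ K, ¬ A ⊆ s → s ∈ L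
  exchange : ∀ s ∈ K, A ⊆ s → ∀ a ∈ A, s.erase a ∪ B ∈ L

/-- A vertex of `A` with least mass loses all of it, so the new support avoids that vertex and gains
at most `B`; this is the face supplied by `exchange`. If the face does not contain `A`, the least
mass is `0` and nothing moves. -/
theorem moveMass_mem_polyhedron {K L : Set (Finset V)} {A B : Finset V}
    (h : IsBistellarHalf K L A B) (hA : A.Nonempty) (hB : B.Nonempty) {x : V → ℝ}
    (hx : x ∈ polyhedron K) : moveMass A B hA x ∈ polyhedron L := by
  obtain ⟨⟨h0, h1⟩, s, hs, hsx⟩ := hx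
  have hm0 : 0 ≤ A.inf' hA x := (Finset.le_inf'_iff _ _).mpr fun a _ => h0 a
  have hmle : ∀ a ∈ A, A.inf' hA x ≤ x a := fun a ha => Finset.inf'_le _ ha
  have hBc : (B.card : ℝ) ≠ 0 := by exact_mod_cast hB.card_ne_zero
  refine ⟨⟨fun v => ?_, ?_⟩, ?_⟩
  · unfold moveMass
    have h2 : 0 ≤ (A.card / B.card : ℝ) * A.inf' hA x := by positivity
    have := h0 v
    split_ifs with ha hb hb
    · linarith [hmle v ha]
    · linarith [hmle v ha]
    · linarith
    · linarith
  · unfold moveMass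
    rw [Finset.sum_add_distrib, Finset.sum_sub_distrib, h1]
    simp only [Finset.sum_ite_mem, Finset.univ_inter, Finset.sum_const, nsmul_eq_mul]
    field_simp
    ring
  · by_cases hAs : A ⊆ s
    · obtain ⟨a, ha, hax⟩ := Finset.exists_mem_eq_inf' hA x
      refine ⟨_, h.exchange s hs hAs a ha, fun v hv => ?_⟩
      simp only [Finset.mem_union, Finset.mem_erase, not_or, not_and] at hv
      unfold moveMass
      rw [if_neg hv.2, add_zero]
      by_cases hva : v = a
      · subst hva
        simp [ha, hax]
      · have hvs := hv.1 hva
        rw [hsx v hvs, if_neg fun hvA => hvs (hAs hvA), sub_zero]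
    · obtain ⟨a, ha, has⟩ := Finset.not_subset.mp hAs
      have hm : A.inf' hA x = 0 := le_antisymm (by simpa [hsx a has] using hmle a ha) hm0
      refine ⟨s, h.mem s hs hAs, fun v hv => ?_⟩
      simp [moveMass, hm, hsx v hv]

/-- Since `B` is contained in no face of `K`, some vertex of `B` carries no mass at first. After the
move the least mass on `B` is therefore exactly the amount received per vertex, and the reverse move
returns it. -/
theorem moveMass_moveMass {K L : Set (Finset V)} {A B : Finset V} (hAB : Disjoint A B)
    (h : IsBistellarHalf K L A B) (hA : A.Nonempty) (hB : B.Nonempty) {x : V → ℝ}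
    (hx : x ∈ polyhedron K) : moveMass B A hB (moveMass A B hA x) = x := by
  obtain ⟨⟨h0, -⟩, s, hs, hsx⟩ := hx
  have hBc : (B.card : ℝ) ≠ 0 := by exact_mod_cast hB.card_ne_zero
  have hAc : (A.card : ℝ) ≠ 0 := by exact_mod_cast hA.card_ne_zero
  obtain ⟨b, hb, hbs⟩ := Finset.not_subset.mp (h.not_subset s hs)
  have hval : ∀ v ∈ B, moveMass A B hA x v = x v + (A.card / B.card : ℝ) * A.inf' hA x := by
    intro v hv
    simp [moveMass, hv, Finset.disjoint_right.mp hAB hv]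
  have hinf : B.inf' hB (moveMass A B hA x) = (A.card / B.card : ℝ) * A.inf' hA x := by
    apply le_antisymm
    · refine (Finset.inf'_le _ hb).trans ?_
      rw [hval b hb, hsx b hbs, zero_add]
    · refine (Finset.le_inf'_iff _ _).mpr fun v hv => ?_
      rw [hval v hv]
      linarith [h0 v]
  funext v
  rw [moveMass, hinf]
  unfold moveMass
  have : (B.card / A.card : ℝ) * ((A.card / B.card : ℝ) * A.inf' hA x) = A.inf' hA x := by
    field_simp
  rw [this]
  ring

/-- Complexes related by a bistellar move have homeomorphic polyhedra. -/
noncomputable def bistellarHomeomorph {K L : Set (Finset V)} {A B : Finset V}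
    (hA : A.Nonempty) (hB : B.Nonempty) (hAB : Disjoint A B)
    (h : IsBistellarHalf K L A B) (h' : IsBistellarHalf L K B A) :
    polyhedron K ≃ₜ polyhedron L where
  toFun x := ⟨moveMass A B hA x, moveMass_mem_polyhedron h hA hB x.2⟩
  invFun x := ⟨moveMass B A hB x, moveMass_mem_polyhedron h' hB hA x.2⟩
  left_inv x := Subtype.ext (moveMass_moveMass hAB h hA hB x.2)
  right_inv x := Subtype.ext (moveMass_moveMass hAB.symm h' hB hA x.2)
  continuous_toFun := ((continuous_moveMass A B hA).comp continuous_subtype_val).subtype_mk _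
  continuous_invFun := ((continuous_moveMass B A hB).comp continuous_subtype_val).subtype_mk _

/-- The complex obtained from `K` by replacing the faces containing `A` with new ones
containing `B`. -/
def bistellar (K : Set (Finset V)) (A B : Finset V) : Set (Finset V) :=
  {s | ¬ A ⊆ s ∧ (s ∈ K ∨ B ⊆ s ∧ (s \ B) ∪ A ∈ K)}

/-- A subface of a new face that loses some `b ∈ B` must be a face of `K`. This is what `hlk`
provides: it says that the link of `A` is joined to the boundary of `B`. -/
theorem isLowerSet_bistellar {K : Set (Finset V)} (hK : IsLowerSet K) {A B : Finset V}
    (hlk : ∀ s ∈ K, A ⊆ s → Disjoint s B → ∀ b ∈ B, s ∪ B.erase b ∈ K)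
    (hAB : Disjoint A B) :
    IsLowerSet (bistellar K A B) := by
  rintro s t hts ⟨hA, hs⟩
  replace hts : t ⊆ s := hts
  refine ⟨fun h => hA (h.trans hts), ?_⟩
  rcases hs with hs | ⟨hBs, hs⟩
  · exact Or.inl (hK hts hs)
  · by_cases hBt : B ⊆ t
    · exact Or.inr ⟨hBt, hK (Finset.union_subset_union (Finset.sdiff_subset_sdiff hts subset_rfl)
        subset_rfl) hs⟩
    · obtain ⟨b, hb, hbt⟩ := Finset.not_subset.mp hBt
      left
      have := hlk _ hs Finset.subset_union_right
        (Finset.disjoint_union_left.mpr ⟨Finset.sdiff_disjoint, hAB⟩) b hb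
      refine hK (fun v hv => ?_) this
      simp only [Finset.mem_union, Finset.mem_sdiff, Finset.mem_erase]
      by_cases hvB : v ∈ B
      · exact Or.inr ⟨fun e => hbt (e ▸ hv), hvB⟩
      · exact Or.inl (Or.inl ⟨hts hv, hvB⟩)

/-- The hypotheses are symmetric in disguise: `hBK` keeps `B` out of `K`, and `A` is kept out of the
result by construction. No purity or manifold condition enters, and a stellar subdivision is the
case where `B` is a single new vertex. -/
theorem nonempty_homeomorph_bistellar {K : Set (Finset V)} (hK : IsLowerSet K) {A B : Finset V}
    (hA : A.Nonempty) (hB : B.Nonempty) (hAB : Disjoint A B) (hBK : ∀ s ∈ K, ¬ B ⊆ s)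
    (hlk : ∀ s ∈ K, A ⊆ s → Disjoint s B → ∀ b ∈ B, s ∪ B.erase b ∈ K) :
    Nonempty (polyhedron K ≃ₜ polyhedron (bistellar K A B)) := by
  refine ⟨bistellarHomeomorph hA hB hAB ⟨hBK, fun s hs hAs => ⟨hAs, Or.inl hs⟩, ?_⟩
    ⟨fun s hs => hs.1, ?_, ?_⟩⟩
  · intro s hs hAs a ha
    have haB : a ∉ B := Finset.disjoint_left.mp hAB ha
    refine ⟨fun h => ?_, Or.inr ⟨Finset.subset_union_right, hK (fun v hv => ?_) hs⟩⟩
    · have := h ha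
      simp [haB] at this
    · simp only [Finset.mem_union, Finset.mem_sdiff, Finset.mem_erase] at hv
      rcases hv with ⟨⟨-, h⟩ | h, h'⟩ | h
      · exact h
      · exact absurd h h'
      · exact hAs h
  · rintro s ⟨-, hs | hs⟩ hBs
    · exact hs
    · exact absurd hs.1 hBs
  · rintro s ⟨-, hs | ⟨-, hs⟩⟩ hBs b hb
    · exact absurd hBs (hBK s hs)
    · have := hlk _ hs Finset.subset_union_right
        (Finset.disjoint_union_left.mpr ⟨Finset.sdiff_disjoint, hAB⟩) b hb
      refine hK (fun v hv => ?_) this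
      simp only [Finset.mem_union, Finset.mem_sdiff, Finset.mem_erase] at hv ⊢
      tauto

/-- The stellar subdivision of `K` at the face `A` with new vertex `b`. -/
abbrev stellar (K : Set (Finset V)) (A : Finset V) (b : V) : Set (Finset V) :=
  bistellar K A {b}

theorem isLowerSet_stellar {K : Set (Finset V)} (hK : IsLowerSet K) {A : Finset V} {b : V}
    (hb : b ∉ A) : IsLowerSet (stellar K A b) :=
  isLowerSet_bistellar hK (fun s hs _ _ b' hb' => by
    rw [Finset.mem_singleton] at hb'
    simpa [hb'] using hs) (by simpa using hb)

theorem nonempty_homeomorph_stellar {K : Set (Finset V)} (hK : IsLowerSet K) {A : Finset V}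
    {b : V} (hA : A.Nonempty) (hb : b ∉ A) (hbK : {b} ∉ K) :
    Nonempty (polyhedron K ≃ₜ polyhedron (stellar K A b)) :=
  nonempty_homeomorph_bistellar hK hA (Finset.singleton_nonempty b) (by simpa using hb)
    (fun _ hs hbs => hbK (hK hbs hs)) (fun s hs _ _ b' hb' => by
      rw [Finset.mem_singleton] at hb'
      simpa [hb'] using hs)

/-- The image of a complex under a map of vertices. -/
def mapFaces {W : Type*} [DecidableEq W] (f : V ↪ W) (K : Set (Finset V)) : Set (Finset W) :=
  (Finset.map f) '' K

theorem isLowerSet_mapFaces {W : Type*} [DecidableEq W] (f : V ↪ W) {K : Set (Finset V)}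
    (hK : IsLowerSet K) : IsLowerSet (mapFaces f K) := by
  rintro _ t ht ⟨s, hs, rfl⟩
  obtain ⟨u, hu, rfl⟩ := Finset.subset_map_iff.mp (show t ⊆ _ from ht)
  exact ⟨u, hK hu hs, rfl⟩

theorem nonempty_homeomorph_mapFaces {W : Type*} [DecidableEq W] [Fintype W] (f : V ↪ W)
    (K : Set (Finset V)) : Nonempty (polyhedron K ≃ₜ polyhedron (mapFaces f K)) := by
  classical
  let F : (V → ℝ) → (W → ℝ) := fun x w => if h : ∃ v, f v = w then x h.choose else 0
  have hF : ∀ x v, F x (f v) = x v := by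
    intro x v
    have h : ∃ v', f v' = f v := ⟨v, rfl⟩
    simp only [F, dif_pos h]
    exact congrArg x (f.injective h.choose_spec)
  have hF0 : ∀ x w, (∀ v, f v ≠ w) → F x w = 0 := by
    intro x w h
    simp only [F]
    rw [dif_neg]
    rintro ⟨v, hv⟩
    exact h v hv
  have hFc : Continuous F := by
    refine continuous_pi fun w => ?_
    by_cases h : ∃ v, f v = w
    · simp only [F, dif_pos h]
      exact continuous_apply _
    · simp only [F, dif_neg h]
      exact continuous_const
  have hsum : ∀ y : W → ℝ, (∀ w, (∀ v, f v ≠ w) → y w = 0) → ∑ w, y w = ∑ v, y (f v) := by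
    intro y hy
    rw [← Finset.sum_map Finset.univ f y]
    symm
    refine Finset.sum_subset (Finset.subset_univ _) fun w _ hw => hy w fun v hv => hw ?_
    simp [← hv]
  refine ⟨{ toFun := fun x => ⟨F x, ?_⟩, invFun := fun y => ⟨fun v => y.1 (f v), ?_⟩,
            left_inv := ?_, right_inv := ?_, continuous_toFun := ?_, continuous_invFun := ?_ }⟩
  · obtain ⟨x, ⟨h0, h1⟩, s, hs, hsx⟩ := x
    refine ⟨⟨fun w => ?_, ?_⟩, s.map f, ⟨s, hs, rfl⟩, fun w hw => ?_⟩
    · simp only [F]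
      split_ifs
      · exact h0 _
      · exact le_rfl
    · rw [hsum _ (hF0 x)]
      simpa only [hF] using h1
    · by_cases h : ∃ v, f v = w
      · obtain ⟨v, rfl⟩ := h
        rw [hF]
        exact hsx v (by simpa using hw)
      · exact hF0 x w fun v hv => h ⟨v, hv⟩
  · obtain ⟨y, ⟨h0, h1⟩, _, ⟨s, hs, rfl⟩, hsy⟩ := y
    refine ⟨⟨fun v => h0 _, ?_⟩, s, hs, fun v hv => hsy _ (by simpa using hv)⟩
    refine (hsum y ?_).symm.trans h1
    intro w hw
    refine hsy w fun h => ?_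
    obtain ⟨v, -, hv⟩ := Finset.mem_map.mp h
    exact hw v hv
  · intro x
    exact Subtype.ext (funext fun v => hF _ _)
  · rintro ⟨y, ⟨h0, h1⟩, _, ⟨s, hs, rfl⟩, hsy⟩
    refine Subtype.ext (funext fun w => ?_)
    by_cases h : ∃ v, f v = w
    · obtain ⟨v, rfl⟩ := h
      exact hF _ _
    · have h' : ∀ v, f v ≠ w := fun v hv => h ⟨v, hv⟩
      refine (hF0 _ _ h').trans (hsy w fun h => ?_).symm
      obtain ⟨v, -, hv⟩ := Finset.mem_map.mp h
      exact h' v hv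
  · exact (hFc.comp continuous_subtype_val).subtype_mk _
  · have hG : Continuous fun (y : W → ℝ) v => y (f v) :=
      continuous_pi fun v => continuous_apply (f v)
    exact (hG.comp continuous_subtype_val).subtype_mk _

end Realization

/-! ### Three cross-polytopal cylinders as a mapping torus -/

section CrossCylinders

variable {d : ℕ}

/-- The boundary of the unit cube with the stars of two opposite corners removed: a model of the
sphere of dimension `d - 2`. -/
def cubeSphere (d : ℕ) : Set (Fin d → ℝ) :=
  {w | (∀ i, 0 ≤ w i) ∧ (∀ i, w i ≤ 1) ∧ (∃ i, w i = 0) ∧ ∃ i, w i = 1}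

/-- The antipode in `cubeSphere`, followed by a permutation of the coordinates. -/
def cubeAntipode (σ : Equiv.Perm (Fin d)) (w : cubeSphere d) : cubeSphere d :=
  ⟨fun i => 1 - w.1 (σ i), by
    obtain ⟨w, h0, h1, ⟨i, hi⟩, ⟨j, hj⟩⟩ := w
    exact ⟨fun k => by simpa using h1 _, fun k => by simpa using h0 _,
      ⟨σ.symm j, by simp [hj]⟩, ⟨σ.symm i, by simp [hi]⟩⟩⟩

/-- The identification of the labels of level `c` with those of level `c + 1`: only the last
cylinder is twisted. -/
def glue (σ : Equiv.Perm (Fin d)) (c : Fin 3) : Equiv.Perm (Fin d) :=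
  if c = 2 then σ else Equiv.refl _

/-- The faces of the `c`-th cylinder: the boundary of the cross-polytope whose antipodal pairs are
`(c, i)` and `(c + 1, glue σ c i)`, without the two facets that form a whole level. -/
structure IsCylinderFace (σ : Equiv.Perm (Fin d)) (c : Fin 3) (s : Finset (Fin 3 × Fin d)) :
    Prop where
  level : ∀ p ∈ s, p.1 = c ∨ p.1 = c + 1
  antipodal : ∀ i, (c, i) ∈ s → (c + 1, glue σ c i) ∉ s
  lower : ∃ i, (c, i) ∉ s
  upper : ∃ i, (c + 1, i) ∉ s

/-- Three cross-polytopal cylinders glued cyclically. -/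
def crossTorus (σ : Equiv.Perm (Fin d)) : Set (Finset (Fin 3 × Fin d)) :=
  {s | ∃ c, IsCylinderFace σ c s}

theorem IsCylinderFace.mono {σ : Equiv.Perm (Fin d)} {c : Fin 3} {s t : Finset (Fin 3 × Fin d)}
    (h : IsCylinderFace σ c s) (hts : t ⊆ s) : IsCylinderFace σ c t where
  level p hp := h.level p (hts hp)
  antipodal i hi hi' := h.antipodal i (hts hi) (hts hi')
  lower := h.lower.imp fun _ hi hi' => hi (hts hi')
  upper := h.upper.imp fun _ hi hi' => hi (hts hi')

theorem isLowerSet_crossTorus (σ : Equiv.Perm (Fin d)) : IsLowerSet (crossTorus σ) :=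
  fun _ _ hts ⟨c, h⟩ => ⟨c, h.mono hts⟩

/-- The point at height `θ` over `w` in the `c`-th cylinder, in unnormalised barycentric
coordinates. -/
noncomputable def cylinderPoint (σ : Equiv.Perm (Fin d)) (c : Fin 3) (w : Fin d → ℝ) (θ : ℝ)
    (p : Fin 3 × Fin d) : ℝ :=
  if p.1 = c then max 0 (w p.2 - θ)
  else if p.1 = c + 1 then max 0 (θ - w ((glue σ c).symm p.2)) else 0

theorem cylinderPoint_lower (σ : Equiv.Perm (Fin d)) (c : Fin 3) (w : Fin d → ℝ) (θ : ℝ)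
    (i : Fin d) : cylinderPoint σ c w θ (c, i) = max 0 (w i - θ) := by
  simp [cylinderPoint]

theorem cylinderPoint_upper (σ : Equiv.Perm (Fin d)) (c : Fin 3) (w : Fin d → ℝ) (θ : ℝ)
    (i : Fin d) : cylinderPoint σ c w θ (c + 1, glue σ c i) = max 0 (θ - w i) := by
  simp [cylinderPoint]

theorem cylinderPoint_nonneg (σ : Equiv.Perm (Fin d)) (c : Fin 3) (w : Fin d → ℝ) (θ : ℝ)
    (p : Fin 3 × Fin d) : 0 ≤ cylinderPoint σ c w θ p := by
  unfold cylinderPoint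
  split_ifs <;> simp

theorem max_zero_sub_max_zero (a b : ℝ) : max 0 (a - b) - max 0 (b - a) = a - b := by
  rcases le_total a b with h | h
  · rw [max_eq_left (by linarith), max_eq_right (by linarith)]; ring
  · rw [max_eq_right (by linarith), max_eq_left (by linarith)]; ring

theorem cylinderPoint_diff (σ : Equiv.Perm (Fin d)) (c : Fin 3) (w : Fin d → ℝ) (θ : ℝ)
    (i : Fin d) : cylinderPoint σ c w θ (c, i) - cylinderPoint σ c w θ (c + 1, glue σ c i)
      = w i - θ := by
  rw [cylinderPoint_lower, cylinderPoint_upper, max_zero_sub_max_zero]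

theorem exists_cylinderPoint_pos (σ : Equiv.Perm (Fin d)) (c : Fin 3) {w : Fin d → ℝ}
    (hw : w ∈ cubeSphere d) (θ : ℝ) : ∃ p, 0 < cylinderPoint σ c w θ p := by
  obtain ⟨-, -, ⟨i, hi⟩, ⟨j, hj⟩⟩ := hw
  rcases lt_or_ge θ 1 with h | h
  · refine ⟨(c, j), ?_⟩
    rw [cylinderPoint_lower, hj]
    exact lt_max_of_lt_right (by linarith)
  · refine ⟨(c + 1, glue σ c i), ?_⟩
    rw [cylinderPoint_upper, hi]
    exact lt_max_of_lt_right (by linarith)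

theorem exists_isCylinderFace_cylinderPoint (σ : Equiv.Perm (Fin d)) (c : Fin 3) {w : Fin d → ℝ}
    (hw : w ∈ cubeSphere d) {θ : ℝ} (h0 : 0 ≤ θ) (h1 : θ ≤ 1) :
    ∃ s, IsCylinderFace σ c s ∧ ∀ p, p ∉ s → cylinderPoint σ c w θ p = 0 := by
  classical
  obtain ⟨-, -, ⟨i, hi⟩, ⟨j, hj⟩⟩ := hw
  refine ⟨Finset.univ.filter fun p => cylinderPoint σ c w θ p ≠ 0, ⟨?_, ?_, ⟨i, ?_⟩,
    ⟨glue σ c j, ?_⟩⟩, ?_⟩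
  · intro p hp
    by_contra h
    push Not at h
    exact (Finset.mem_filter.mp hp).2 (by simp [cylinderPoint, h.1, h.2])
  · intro k hk hk'
    simp only [Finset.mem_filter, Finset.mem_univ, true_and, cylinderPoint_lower,
      cylinderPoint_upper] at hk hk'
    rcases le_total (w k) θ with h | h
    · exact hk (max_eq_left (by linarith))
    · exact hk' (max_eq_left (by linarith))
  · simp [cylinderPoint_lower, hi, h0]
  · simp [cylinderPoint_upper, hj, h1]
  · intro p hp
    simpa using hp

/-- Differences of antipodal coordinates give `w - θ = r (w' - θ')`. Both vectors `w`, `w'` have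
minimum `0` and maximum `1`; comparing the extremes forces `r = 1`. -/
theorem cylinderPoint_injective {σ : Equiv.Perm (Fin d)} {c : Fin 3} {w w' : Fin d → ℝ}
    (hw : w ∈ cubeSphere d) (hw' : w' ∈ cubeSphere d) {θ θ' r : ℝ} (hr : 0 < r)
    (h : ∀ p, cylinderPoint σ c w θ p = r * cylinderPoint σ c w' θ' p) : w = w' ∧ θ = θ' := by
  have key : ∀ i, w i - θ = r * (w' i - θ') := by
    intro i
    rw [← cylinderPoint_diff σ c, ← cylinderPoint_diff σ c, h, h]
    ring
  obtain ⟨a0, a1, ⟨i, hi⟩, ⟨j, hj⟩⟩ := hw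
  obtain ⟨b0, b1, ⟨i', hi'⟩, ⟨j', hj'⟩⟩ := hw'
  have e1 : -θ = r * -θ' := by
    apply le_antisymm
    · have := key i'
      rw [hi'] at this
      linarith [a0 i']
    · have := key i
      rw [hi] at this
      nlinarith [mul_nonneg hr.le (b0 i)]
  have e2 : 1 - θ = r * (1 - θ') := by
    apply le_antisymm
    · have := key j
      rw [hj] at this
      nlinarith [mul_le_mul_of_nonneg_left (b1 j) hr.le]
    · have := key j'
      rw [hj'] at this
      linarith [a1 j']
  have hr1 : r = 1 := by linarith
  subst hr1
  have hθ : θ = θ' := by linarith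
  refine ⟨funext fun k => ?_, hθ⟩
  have := key k
  linarith

/-- Antipodal coordinates of `x` are never both nonzero, so `x` is encoded by the signed vector `v`
of their differences. The two missing facets give `min v ≤ 0 ≤ max v`. -/
theorem exists_cylinderPoint_eq {σ : Equiv.Perm (Fin d)} {c : Fin 3}
    {s : Finset (Fin 3 × Fin d)} (hs : IsCylinderFace σ c s) {x : Fin 3 × Fin d → ℝ}
    (h0 : ∀ p, 0 ≤ x p) (hx : ∃ p, x p ≠ 0) (hsx : ∀ p, p ∉ s → x p = 0) :
    ∃ w ∈ cubeSphere d, ∃ θ : ℝ, 0 ≤ θ ∧ θ ≤ 1 ∧ ∃ r : ℝ, 0 < r ∧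
      ∀ p, cylinderPoint σ c w θ p = r * x p := by
  obtain ⟨i₀, hi₀⟩ := hs.lower
  obtain ⟨j₀, hj₀⟩ := hs.upper
  have : Nonempty (Fin d) := ⟨i₀⟩
  let v : Fin d → ℝ := fun i => x (c, i) - x (c + 1, glue σ c i)
  obtain ⟨a, ha⟩ := Finite.exists_min v
  obtain ⟨b, hb⟩ := Finite.exists_max v
  have hprod : ∀ i, x (c, i) = 0 ∨ x (c + 1, glue σ c i) = 0 := by
    intro i
    by_cases h : (c, i) ∈ s
    · exact Or.inr (hsx _ (hs.antipodal i h))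
    · exact Or.inl (hsx _ h)
  have hlow : ∀ i, max 0 (v i) = x (c, i) := by
    intro i
    rcases hprod i with h | h
    · simp [v, h, h0]
    · simp [v, h, h0]
  have hupp : ∀ i, max 0 (-v i) = x (c + 1, glue σ c i) := by
    intro i
    rcases hprod i with h | h
    · simp [v, h, h0]
    · simp [v, h, h0]
  have ha0 : v a ≤ 0 := by
    refine (ha i₀).trans ?_
    simp [v, hsx _ hi₀, h0]
  have hb0 : 0 ≤ v b := by
    refine le_trans ?_ (hb ((glue σ c).symm j₀))
    simp [v, hsx _ hj₀, h0]
  have hab : 0 < v b - v a := by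
    by_contra hcon
    have hva : v a = 0 := by linarith
    have hvb : v b = 0 := by linarith
    have hv : ∀ i, v i = 0 := fun i => le_antisymm (hvb ▸ hb i) (hva ▸ ha i)
    obtain ⟨⟨e, i⟩, hp⟩ := hx
    apply hp
    by_cases hps : (e, i) ∈ s
    · rcases hs.level _ hps with h | h
      · simp only at h
        rw [h, ← hlow i, hv i, max_self]
      · simp only at h
        obtain ⟨k, rfl⟩ := (glue σ c).surjective i
        rw [h, ← hupp k, hv k, neg_zero, max_self]
    · exact hsx _ hps
  -- The affine map sending the minimum of `v` to `0` and its maximum to `1` takes `v` to `w` and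
  -- the value `0` to the height `θ`.
  refine ⟨fun i => (v i - v a) / (v b - v a), ⟨fun i => ?_, fun i => ?_, ⟨a, by simp⟩,
    ⟨b, div_self hab.ne'⟩⟩, -v a / (v b - v a), div_nonneg (by linarith) hab.le, ?_,
    1 / (v b - v a), by positivity, ?_⟩
  · exact div_nonneg (by linarith [ha i]) hab.le
  · rw [div_le_one hab]; linarith [hb i]
  · rw [div_le_one hab]; linarith
  · rintro ⟨e, i⟩
    have hpos : (0 : ℝ) ≤ 1 / (v b - v a) := by positivity
    by_cases he : e = c
    · subst he
      rw [cylinderPoint_lower, ← hlow i, mul_max_of_nonneg _ _ hpos, mul_zero]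
      congr 1
      field_simp
      ring
    · by_cases he' : e = c + 1
      · subst he'
        obtain ⟨k, rfl⟩ := (glue σ c).surjective i
        rw [cylinderPoint_upper, ← hupp k, mul_max_of_nonneg _ _ hpos, mul_zero]
        congr 1
        field_simp
        ring
      · have : (e, i) ∉ s := fun h => (hs.level _ h).elim he he'
        rw [hsx _ this]
        simp [cylinderPoint, he, he']

/-- The winding of `cubeSphere d × [0, 3]` around the three cylinders. -/
noncomputable def winding (σ : Equiv.Perm (Fin d)) (w : Fin d → ℝ) (T : ℝ)
    (p : Fin 3 × Fin d) : ℝ :=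
  if p.1 = 0 then max 0 (w p.2 - T) + max 0 (T - 2 - w (σ.symm p.2))
  else if p.1 = 1 then max 0 (1 - |T - 1| - w p.2)
  else max 0 (w p.2 - |T - 2|)

theorem continuous_winding (σ : Equiv.Perm (Fin d)) (p : Fin 3 × Fin d) :
    Continuous fun q : (Fin d → ℝ) × ℝ => winding σ q.1 q.2 p := by
  unfold winding
  split_ifs <;> fun_prop

theorem winding_first (σ : Equiv.Perm (Fin d)) {w : Fin d → ℝ} (hw : w ∈ cubeSphere d) {T : ℝ}
    (h1 : T ≤ 1) : winding σ w T = cylinderPoint σ 0 w T := by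
  funext ⟨c, i⟩
  fin_cases c
  · have := hw.1 (σ.symm i)
    simp only [winding, cylinderPoint]
    rw [max_eq_left (a := (0 : ℝ)) (b := T - 2 - _) (by linarith)]
    simp
  · simp [winding, cylinderPoint, glue, abs_of_nonpos (show T - 1 ≤ 0 by linarith)]
  · have := hw.2.1 i
    simp [winding, cylinderPoint, abs_of_nonpos (show T - 2 ≤ 0 by linarith)]
    linarith

/-- At the top of the first cylinder the level-1 coordinates are `1 - w`, so the second cylinder is
traversed over the antipode; in the third one the point is `w` again. -/
theorem winding_second (σ : Equiv.Perm (Fin d)) {w : Fin d → ℝ} (hw : w ∈ cubeSphere d) {T : ℝ}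
    (h0 : 1 ≤ T) (h1 : T ≤ 2) :
    winding σ w T = cylinderPoint σ 1 (fun i => 1 - w i) (T - 1) := by
  funext ⟨c, i⟩
  fin_cases c
  · have := hw.1 (σ.symm i)
    have := hw.2.1 i
    simp only [winding, cylinderPoint]
    rw [max_eq_left (a := (0 : ℝ)) (b := T - 2 - _) (by linarith),
      max_eq_left (a := (0 : ℝ)) (b := w i - T) (by linarith)]
    simp
  · simp only [winding, cylinderPoint, abs_of_nonneg (show 0 ≤ T - 1 by linarith)]
    simp
    congr 1
    ring
  · simp [winding, cylinderPoint, glue, abs_of_nonpos (show T - 2 ≤ 0 by linarith)]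
    congr 1
    ring

theorem winding_third (σ : Equiv.Perm (Fin d)) {w : Fin d → ℝ} (hw : w ∈ cubeSphere d) {T : ℝ}
    (h0 : 2 ≤ T) : winding σ w T = cylinderPoint σ 2 w (T - 2) := by
  funext ⟨c, i⟩
  fin_cases c
  · have := hw.2.1 i
    simp only [winding, cylinderPoint]
    rw [max_eq_left (a := (0 : ℝ)) (b := w i - T) (by linarith)]
    simp [glue]
  · have := hw.1 i
    simp [winding, cylinderPoint, abs_of_nonneg (show 0 ≤ T - 1 by linarith)]
    linarith
  · simp [winding, cylinderPoint, abs_of_nonneg (show 0 ≤ T - 2 by linarith)]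

theorem one_sub_mem_cubeSphere {w : Fin d → ℝ} (hw : w ∈ cubeSphere d) :
    (fun i => 1 - w i) ∈ cubeSphere d :=
  (cubeAntipode 1 ⟨w, hw⟩).2

/-- Every point of the winding lies in a cylinder. -/
theorem winding_eq_cylinderPoint (σ : Equiv.Perm (Fin d)) {w : Fin d → ℝ}
    (hw : w ∈ cubeSphere d) {T : ℝ} (h0 : 0 ≤ T) (h3 : T ≤ 3) :
    ∃ c, ∃ w' ∈ cubeSphere d, ∃ θ, 0 ≤ θ ∧ θ ≤ 1 ∧ winding σ w T = cylinderPoint σ c w' θ := by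
  rcases le_total T 1 with h | h
  · exact ⟨0, w, hw, T, h0, h, winding_first σ hw h⟩
  · rcases le_total T 2 with h' | h'
    · exact ⟨1, _, one_sub_mem_cubeSphere hw, T - 1, by linarith, by linarith,
        winding_second σ hw h h'⟩
    · exact ⟨2, w, hw, T - 2, by linarith, by linarith, winding_third σ hw h'⟩

theorem cylinderPoint_eq_winding (σ : Equiv.Perm (Fin d)) (c : Fin 3) {w : Fin d → ℝ}
    (hw : w ∈ cubeSphere d) {θ : ℝ} (h0 : 0 ≤ θ) (h1 : θ ≤ 1) :
    ∃ w' ∈ cubeSphere d, ∃ T, 0 ≤ T ∧ T ≤ 3 ∧ cylinderPoint σ c w θ = winding σ w' T := by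
  fin_cases c
  · exact ⟨w, hw, θ, h0, by linarith, (winding_first σ hw h1).symm⟩
  · refine ⟨_, one_sub_mem_cubeSphere hw, θ + 1, by linarith, by linarith, ?_⟩
    rw [winding_second σ (one_sub_mem_cubeSphere hw) (by linarith) (by linarith)]
    simp
  · refine ⟨w, hw, θ + 2, by linarith, by linarith, ?_⟩
    rw [winding_third σ hw (by linarith)]
    simp

theorem exists_winding_one_pos (σ : Equiv.Perm (Fin d)) {w : Fin d → ℝ}
    (hw : w ∈ cubeSphere d) {T : ℝ} (h0 : 0 < T) (h2 : T < 2) :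
    ∃ i, 0 < winding σ w T (1, i) := by
  obtain ⟨-, -, ⟨i, hi⟩, -⟩ := hw
  refine ⟨i, ?_⟩
  have : |T - 1| < 1 := abs_lt.mpr ⟨by linarith, by linarith⟩
  simp [winding, hi, this]

theorem winding_one_eq (σ : Equiv.Perm (Fin d)) {w : Fin d → ℝ}
    (hw : w ∈ cubeSphere d) {T : ℝ} (h : T ≤ 0 ∨ 2 ≤ T) (i : Fin d) :
    winding σ w T (1, i) = 0 := by
  have := hw.1 i
  have : 1 ≤ |T - 1| := by
    rcases h with h | h
    · exact le_abs.mpr (Or.inr (by linarith))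
    · exact le_abs.mpr (Or.inl (by linarith))
  simp [winding]
  linarith

theorem exists_winding_two_pos (σ : Equiv.Perm (Fin d)) {w : Fin d → ℝ}
    (hw : w ∈ cubeSphere d) {T : ℝ} (h1 : 1 < T) (h3 : T < 3) :
    ∃ i, 0 < winding σ w T (2, i) := by
  obtain ⟨-, -, -, ⟨j, hj⟩⟩ := hw
  refine ⟨j, ?_⟩
  have : |T - 2| < 1 := abs_lt.mpr ⟨by linarith, by linarith⟩
  simp [winding, hj, this]

theorem winding_two_eq (σ : Equiv.Perm (Fin d)) {w : Fin d → ℝ}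
    (hw : w ∈ cubeSphere d) {T : ℝ} (h : T ≤ 1) (i : Fin d) :
    winding σ w T (2, i) = 0 := by
  have := hw.2.1 i
  have : 1 ≤ |T - 2| := le_abs.mpr (Or.inr (by linarith))
  simp [winding]
  linarith

/-- The levels that carry mass reveal the cylinder: level 1 does so just for `0 < T < 2`, level 2
just for `1 < T < 3`. Within one cylinder `cylinderPoint_injective` applies; across cylinders only
the ends `0` and `3` can meet. -/
theorem winding_injective {σ : Equiv.Perm (Fin d)} {w w' : cubeSphere d} {T T' r : ℝ}
    (hT : 0 ≤ T) (hTT : T ≤ T') (hT' : T' ≤ 3) (hr : 0 < r)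
    (h : ∀ p, winding σ w T p = r * winding σ w' T' p) :
    (w = w' ∧ T = T') ∨ (T = 0 ∧ T' = 3 ∧ w' = cubeAntipode σ w) := by
  have hpos : ∀ p, 0 < winding σ w T p → winding σ w' T' p = 0 → False := by
    intro p hp hp'
    rw [h, hp', mul_zero] at hp
    exact hp.false
  have hpos' : ∀ p, 0 < winding σ w' T' p → winding σ w T p = 0 → False := by
    intro p hp hp'
    rw [h] at hp'
    exact (mul_pos hr hp).ne' hp'
  rcases le_or_gt T' 1 with a | a
  · left
    rw [winding_first σ w.2 (by linarith), winding_first σ w'.2 a] at h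
    obtain ⟨h1, h2⟩ := cylinderPoint_injective w.2 w'.2 hr h
    exact ⟨Subtype.ext h1, h2⟩
  rcases le_or_gt T' 2 with b | b
  · rcases lt_or_ge T 1 with e | e
    · obtain ⟨i, hi⟩ := exists_winding_two_pos σ w'.2 a (by linarith)
      exact (hpos' _ hi (winding_two_eq σ w.2 e.le i)).elim
    · left
      rw [winding_second σ w.2 e (by linarith), winding_second σ w'.2 a.le b] at h
      obtain ⟨h1, h2⟩ := cylinderPoint_injective (one_sub_mem_cubeSphere w.2)
        (one_sub_mem_cubeSphere w'.2) hr h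
      refine ⟨Subtype.ext (funext fun i => ?_), by linarith⟩
      have : 1 - w.1 i = 1 - w'.1 i := congrFun h1 i
      linarith
  rcases le_or_gt 2 T with e | e
  · left
    rw [winding_third σ w.2 e, winding_third σ w'.2 b.le] at h
    obtain ⟨h1, h2⟩ := cylinderPoint_injective w.2 w'.2 hr h
    exact ⟨Subtype.ext h1, by linarith⟩
  have hT0 : T = 0 := by
    by_contra hne
    obtain ⟨i, hi⟩ := exists_winding_one_pos σ w.2 (lt_of_le_of_ne hT (Ne.symm hne)) e
    exact hpos _ hi (winding_one_eq σ w'.2 (Or.inr b.le) i)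
  subst hT0
  have hT3 : T' = 3 := by
    by_contra hne
    obtain ⟨i, hi⟩ := exists_winding_two_pos σ w'.2 a (lt_of_le_of_ne hT' hne)
    exact hpos' _ hi (winding_two_eq σ w.2 (by norm_num) i)
  subst hT3
  refine Or.inr ⟨rfl, rfl, ?_⟩
  -- Comparison on level 0: at height `0` it carries `w`, at height `3` it carries `1 - w'`
  -- relabelled by `σ`.
  have key : ∀ i, w.1 (σ i) = r * (1 - w'.1 i) := by
    intro i
    have h1 := h (0, σ i)
    have a0 := w.2.1 (σ i)
    have a1 := w'.2.2.1 i
    have a2 := w'.2.2.1 (σ i)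
    have a3 := w.2.1 i
    simp only [winding, if_true, Equiv.symm_apply_apply] at h1
    rw [max_eq_right (by linarith), max_eq_left (by linarith), max_eq_left (by linarith),
      max_eq_right (by linarith)] at h1
    linarith
  have hr1 : r = 1 := by
    apply le_antisymm
    · obtain ⟨i, hi⟩ := w'.2.2.2.1
      have := key i
      rw [hi] at this
      linarith [w.2.2.1 (σ i)]
    · obtain ⟨j, hj⟩ := w.2.2.2.2
      have := key (σ.symm j)
      rw [Equiv.apply_symm_apply, hj] at this
      nlinarith [mul_nonneg hr.le (w'.2.1 (σ.symm j))]
  subst hr1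
  refine Subtype.ext (funext fun i => ?_)
  have := key i
  simp only [cubeAntipode]
  linarith

theorem winding_sum_pos (σ : Equiv.Perm (Fin d)) (w : cubeSphere d) {T : ℝ}
    (h0 : 0 ≤ T) (h3 : T ≤ 3) : 0 < ∑ p, winding σ w T p := by
  obtain ⟨c, w', hw', θ, -, -, he⟩ := winding_eq_cylinderPoint σ w.2 h0 h3
  rw [he]
  obtain ⟨p, hp⟩ := exists_cylinderPoint_pos σ c hw' θ
  exact Finset.sum_pos' (fun q _ => cylinderPoint_nonneg σ c w' θ q) ⟨p, Finset.mem_univ _, hp⟩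

/-- The polyhedron of the three glued cylinders is a mapping torus. -/
theorem nonempty_homeomorph_crossTorus (σ : Equiv.Perm (Fin d)) [CompactSpace (cubeSphere d)] :
    Nonempty (MappingTorus (cubeAntipode σ) ≃ₜ polyhedron (crossTorus σ)) := by
  have hI : ∀ t : unitInterval, 0 ≤ 3 * (t : ℝ) ∧ 3 * (t : ℝ) ≤ 3 := fun t =>
    ⟨by linarith [t.2.1], by linarith [t.2.2]⟩
  have hS : ∀ p : cubeSphere d × unitInterval, 0 < ∑ q, winding σ p.1 (3 * p.2) q := fun p =>
    winding_sum_pos σ p.1 (hI p.2).1 (hI p.2).2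
  have hmem : ∀ p : cubeSphere d × unitInterval,
      (fun q => winding σ p.1 (3 * p.2) q / ∑ q, winding σ p.1 (3 * p.2) q) ∈
        polyhedron (crossTorus σ) := by
    intro p
    obtain ⟨c, w', hw', θ, hθ0, hθ1, he⟩ :=
      winding_eq_cylinderPoint σ p.1.2 (hI p.2).1 (hI p.2).2
    have hp := hS p
    refine ⟨⟨fun q => div_nonneg ?_ hp.le, ?_⟩, ?_⟩
    · rw [he]
      exact cylinderPoint_nonneg _ _ _ _ _
    · rw [← Finset.sum_div]
      exact div_self hp.ne'
    · obtain ⟨s, hs, hsx⟩ := exists_isCylinderFace_cylinderPoint σ c hw' hθ0 hθ1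
      refine ⟨s, ⟨c, hs⟩, fun q hq => ?_⟩
      simp only [he]
      rw [hsx q hq, zero_div]
  refine MappingTorus.nonempty_homeomorph (fun p => ⟨_, hmem p⟩) ?_ ?_ ?_ ?_
  · have hc : ∀ q, Continuous fun p : cubeSphere d × unitInterval =>
        winding σ p.1 (3 * p.2) q := fun q =>
      (continuous_winding σ q).comp (f := fun p : cubeSphere d × unitInterval =>
        ((p.1 : Fin d → ℝ), (3 * p.2 : ℝ))) (by fun_prop)
    refine Continuous.subtype_mk (continuous_pi fun q => ?_) _
    exact (hc q).div (continuous_finsetSum _ fun q _ => hc q) fun p => (hS p).ne'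
  · rintro ⟨x, ⟨h0, h1⟩, s, ⟨c, hs⟩, hsx⟩
    have hx : ∃ p, x p ≠ 0 := by
      by_contra! hcon
      simp [hcon] at h1
    obtain ⟨w, hw, θ, hθ0, hθ1, r, hr, hwx⟩ := exists_cylinderPoint_eq hs h0 hx hsx
    obtain ⟨w', hw', T, hT0, hT3, he⟩ := cylinderPoint_eq_winding σ c hw hθ0 hθ1
    refine ⟨(⟨w', hw'⟩, ⟨T / 3, by positivity, by linarith⟩), Subtype.ext (funext fun q => ?_)⟩
    have hT : 3 * (T / 3) = T := by ring
    simp only [hT]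
    rw [← he]
    simp only [hwx, ← Finset.mul_sum, h1]
    field_simp
  · intro w
    refine Subtype.ext (funext fun q => ?_)
    have : winding σ w (3 * ((0 : unitInterval) : ℝ)) =
        winding σ (cubeAntipode σ w) (3 * ((1 : unitInterval) : ℝ)) := by
      funext ⟨c, i⟩
      have b1 := w.2.1
      have b2 := w.2.2.1
      simp only [Set.Icc.coe_zero, Set.Icc.coe_one, mul_zero, mul_one]
      fin_cases c
      · simp only [winding, cubeAntipode]
        simp only [Fin.zero_eta, if_true, Equiv.apply_symm_apply]
        rw [max_eq_left (a := (0 : ℝ)) (b := 0 - 2 - _) (by linarith [b1 (σ.symm i)]),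
          max_eq_left (a := (0 : ℝ)) (b := 1 - _ - 3) (by linarith [b1 (σ i)])]
        rw [sub_zero, add_zero, zero_add]
        congr 1
        ring
      · exact (winding_one_eq σ w.2 (Or.inl le_rfl) i).trans
          (winding_one_eq σ (cubeAntipode σ w).2 (Or.inr (by norm_num)) i).symm
      · refine (winding_two_eq σ w.2 (by norm_num) i).trans ?_
        have := b1 (σ i)
        simp [winding, cubeAntipode]
        norm_num
        linarith
    simp only [this]
  · rintro ⟨w, t⟩ ⟨w', t'⟩ htt h
    have h' : ∀ q, winding σ w (3 * t) q / ∑ q, winding σ w (3 * t) q =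
        winding σ w' (3 * t') q / ∑ q, winding σ w' (3 * t') q := fun q =>
      congrFun (congrArg Subtype.val h) q
    have p1 := hS (w, t)
    have p2 := hS (w', t')
    simp only at p1 p2
    have htt' : (t : ℝ) ≤ t' := htt
    rcases winding_injective (hI t).1 (by linarith) (hI t').2 (div_pos p1 p2) (fun q => by
      have := h' q
      field_simp at this ⊢
      linarith) with ⟨h1, h2⟩ | ⟨h1, h2, h3⟩
    · left
      rw [h1, Subtype.ext (show (t : ℝ) = t' by linarith)]
    · right
      exact ⟨Subtype.ext (by simpa using h1),
        Subtype.ext (show (t' : ℝ) = 1 by linarith), h3⟩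

end CrossCylinders

/-! ### The cube model and the round sphere -/

section SphereModel

variable {n : ℕ}

theorem isCompact_cubeSphere (d : ℕ) : IsCompact (cubeSphere d) := by
  refine (isCompact_Icc (a := (0 : Fin d → ℝ)) (b := 1)).of_isClosed_subset ?_ ?_
  · have h1 : IsClosed {w : Fin d → ℝ | ∀ i, 0 ≤ w i} := by
      simp only [Set.ofPred_forall]
      exact isClosed_iInter fun i => isClosed_le continuous_const (continuous_apply i)
    have h2 : IsClosed {w : Fin d → ℝ | ∀ i, w i ≤ 1} := by
      simp only [Set.ofPred_forall]
      exact isClosed_iInter fun i => isClosed_le (continuous_apply i) continuous_const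
    have h3 : ∀ a : ℝ, IsClosed {w : Fin d → ℝ | ∃ i, w i = a} := by
      intro a
      simp only [Set.ofPred_exists]
      exact isClosed_iUnion_of_finite fun i => isClosed_eq (continuous_apply i) continuous_const
    exact h1.inter (h2.inter ((h3 0).inter (h3 1)))
  · exact fun w hw => ⟨hw.1, hw.2.1⟩

instance (d : ℕ) : CompactSpace (cubeSphere d) :=
  isCompact_iff_compactSpace.mp (isCompact_cubeSphere d)

/-- Coordinates on the quotient of `ℝⁿ⁺²` by the line of constant vectors. -/
noncomputable def gather (v : Fin (n + 2) → ℝ) : Fin (n + 1) → ℝ :=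
  Fin.cons ((v 0 - v 1) / 2) fun i : Fin n => v i.succ.succ - (v 0 + v 1) / 2

@[simp] theorem gather_zero (v : Fin (n + 2) → ℝ) : gather v 0 = (v 0 - v 1) / 2 := rfl

@[simp] theorem gather_succ (v : Fin (n + 2) → ℝ) (i : Fin n) :
    gather v i.succ = v i.succ.succ - (v 0 + v 1) / 2 := rfl

theorem continuous_gather : Continuous (gather (n := n)) := by
  refine continuous_pi fun i => ?_
  refine Fin.cases ?_ (fun i => ?_) i
  · simp only [gather_zero]; fun_prop
  · simp only [gather_succ]; fun_prop

theorem eq_of_gather_eq_smul {v v' : Fin (n + 2) → ℝ} {r : ℝ}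
    (h : ∀ i, gather v i = r * gather v' i) (j : Fin (n + 2)) :
    v j = r * v' j + ((v 0 + v 1) / 2 - r * ((v' 0 + v' 1) / 2)) := by
  have h0 := h 0
  simp only [gather_zero] at h0
  refine Fin.cases ?_ (fun j => Fin.cases ?_ (fun j => ?_) j) j
  · linarith
  · change v 1 = r * v' 1 + _
    linarith
  · have := h j.succ
    simp only [gather_succ] at this
    linarith

theorem gather_ne_zero {w : Fin (n + 2) → ℝ} (hw : w ∈ cubeSphere (n + 2)) :
    WithLp.toLp 2 (gather w) ≠ 0 := by
  intro h
  have h' : ∀ i, gather w i = 0 * gather w i := by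
    intro i
    rw [zero_mul]
    exact congrFun (congrArg WithLp.ofLp h) i
  obtain ⟨-, -, ⟨i, hi⟩, ⟨j, hj⟩⟩ := hw
  have h1 := eq_of_gather_eq_smul h' i
  have h2 := eq_of_gather_eq_smul h' j
  rw [hi] at h1
  rw [hj] at h2
  linarith

/-- The radial projection of `cubeSphere (n + 2)` to the unit sphere. -/
noncomputable def toUnitSphere (w : cubeSphere (n + 2)) : UnitSphere n :=
  ⟨‖WithLp.toLp 2 (gather w.1)‖⁻¹ • WithLp.toLp 2 (gather w.1), by
    rw [mem_sphere_zero_iff_norm, norm_smul, norm_inv, norm_norm]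
    exact inv_mul_cancel₀ (norm_ne_zero_iff.mpr (gather_ne_zero w.2))⟩

theorem continuous_toUnitSphere : Continuous (toUnitSphere (n := n)) := by
  have h : Continuous fun w : cubeSphere (n + 2) => WithLp.toLp 2 (gather w.1) :=
    (PiLp.continuous_toLp 2 _).comp (continuous_gather.comp continuous_subtype_val)
  exact ((h.norm.inv₀ fun w => norm_ne_zero_iff.mpr (gather_ne_zero w.2)).smul h).subtype_mk _

/-- Equal directions modulo constants mean `w = r w' + k` with `r > 0`. Minimum `0` and maximum `1`
on both sides force `k = 0` and `r = 1`. -/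
theorem toUnitSphere_injective : Function.Injective (toUnitSphere (n := n)) := by
  intro w w' h
  have ha := norm_pos_iff.mpr (gather_ne_zero w.2)
  have hb := norm_pos_iff.mpr (gather_ne_zero w'.2)
  set a := ‖WithLp.toLp 2 (gather w.1)‖ with hadef
  set b := ‖WithLp.toLp 2 (gather w'.1)‖ with hbdef
  have key : ∀ i, gather w.1 i = a / b * gather w'.1 i := by
    intro i
    have h1 : a⁻¹ * gather w.1 i = b⁻¹ * gather w'.1 i :=
      congrFun (congrArg WithLp.ofLp (congrArg Subtype.val h)) i
    field_simp at h1 ⊢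
    linarith
  have hr : 0 < a / b := div_pos ha hb
  have h2 := eq_of_gather_eq_smul key
  generalize a / b = r at hr h2
  generalize ((w.1 0 + w.1 1) / 2 - r * ((w'.1 0 + w'.1 1) / 2)) = k at h2
  obtain ⟨w, a0, a1, ⟨i, hi⟩, ⟨j, hj⟩⟩ := w
  obtain ⟨w', b0, b1, ⟨i', hi'⟩, ⟨j', hj'⟩⟩ := w'
  simp only at h2
  have hk : k = 0 := by
    apply le_antisymm
    · have := h2 i
      rw [hi] at this
      nlinarith [mul_nonneg hr.le (b0 i)]
    · have := h2 i'
      rw [hi'] at this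
      linarith [a0 i']
  have hr1 : r = 1 := by
    apply le_antisymm
    · have := h2 j'
      rw [hj'] at this
      linarith [a1 j']
    · have := h2 j
      rw [hj] at this
      nlinarith [mul_le_mul_of_nonneg_left (b1 j) hr.le]
  refine Subtype.ext (funext fun l => ?_)
  have := h2 l
  simp only [hk, hr1] at this
  simpa using this

theorem toUnitSphere_surjective : Function.Surjective (toUnitSphere (n := n)) := by
  intro u
  -- The preimage of `u` under `gather` whose first two entries have mean zero; rescaling its range
  -- to `[0, 1]` only changes `gather` by a positive factor.
  let v : Fin (n + 2) → ℝ := Fin.cons (u.1 0) (Fin.cons (-u.1 0) fun i : Fin n => u.1 i.succ)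
  have hv0 : v 0 = u.1 0 := rfl
  have hv1 : v 1 = -u.1 0 := rfl
  have hv2 : ∀ i : Fin n, v i.succ.succ = u.1 i.succ := fun _ => rfl
  obtain ⟨a, ha⟩ := Finite.exists_min v
  obtain ⟨b, hb⟩ := Finite.exists_max v
  have hu : ‖u.1‖ = 1 := mem_sphere_zero_iff_norm.mp u.2
  have hab : 0 < v b - v a := by
    by_contra hcon
    have hc : ∀ i j, v i = v j := fun i j => by linarith [ha i, hb i, ha j, hb j]
    have h0 : u.1 0 = 0 := by
      have := hc 0 1
      rw [hv0, hv1] at this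
      linarith
    have : u.1 = 0 := by
      ext i
      refine Fin.cases ?_ (fun i => ?_) i
      · simpa using h0
      · have := hc i.succ.succ 0
        rw [hv2, hv0, h0] at this
        simpa using this
    rw [this, norm_zero] at hu
    exact zero_ne_one hu
  let w : Fin (n + 2) → ℝ := fun i => (v i - v a) / (v b - v a)
  have hw : w ∈ cubeSphere (n + 2) := by
    refine ⟨fun i => div_nonneg (by linarith [ha i]) hab.le, fun i => ?_, ⟨a, by simp [w]⟩,
      ⟨b, div_self hab.ne'⟩⟩
    simp only [w]
    rw [div_le_one hab]
    linarith [hb i]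
  have hg : WithLp.toLp 2 (gather w) = (v b - v a)⁻¹ • u.1 := by
    ext i
    refine Fin.cases ?_ (fun i => ?_) i
    · simp only [gather_zero, PiLp.smul_apply, smul_eq_mul, w, hv0, hv1]
      field_simp
      ring
    · simp only [gather_succ, PiLp.smul_apply, smul_eq_mul, w, hv0, hv1, hv2]
      field_simp
      ring
  refine ⟨⟨w, hw⟩, Subtype.ext ?_⟩
  simp only [toUnitSphere]
  rw [hg, norm_smul, hu, mul_one, norm_inv, Real.norm_of_nonneg hab.le, smul_smul, inv_inv,
    mul_inv_cancel₀ hab.ne', one_smul]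

/-- The model `cubeSphere (n + 2)` is homeomorphic to the unit sphere. -/
noncomputable def cubeSphereHomeomorph (n : ℕ) : cubeSphere (n + 2) ≃ₜ UnitSphere n :=
  Continuous.homeoOfEquivCompactToT2
    (f := Equiv.ofBijective _ ⟨toUnitSphere_injective, toUnitSphere_surjective⟩)
    continuous_toUnitSphere

theorem norm_toLp_congr {x y : Fin (n + 1) → ℝ} (h : ∀ i, |x i| = |y i|) :
    ‖WithLp.toLp 2 x‖ = ‖WithLp.toLp 2 y‖ := by
  rw [EuclideanSpace.norm_eq, EuclideanSpace.norm_eq]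
  congr 1
  refine Finset.sum_congr rfl fun i _ => ?_
  simp [Real.norm_eq_abs, h i]

theorem toUnitSphere_antipode (w : cubeSphere (n + 2)) :
    toUnitSphere (cubeAntipode 1 w) = -toUnitSphere w := by
  have h : gather (cubeAntipode 1 w).1 = -gather w.1 := by
    funext i
    refine Fin.cases ?_ (fun i => ?_) i
    · simp [cubeAntipode]; ring
    · simp [cubeAntipode]; ring
  refine Subtype.ext ?_
  simp only [toUnitSphere, h]
  rw [norm_toLp_congr (x := -gather w.1) (y := gather w.1) fun i => by simp]
  ext i
  simp

/-- The first coordinate of `gather` is half the difference of the entries `0` and `1`, and the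
others see these entries only through their mean. So the transposition acts as the reflection, while
the antipode negates everything. -/
theorem toUnitSphere_antipode_swap (w : cubeSphere (n + 2)) :
    toUnitSphere (cubeAntipode (Equiv.swap 0 1) w) = -sphereReflection n (toUnitSphere w) := by
  have h0 : gather (cubeAntipode (Equiv.swap 0 1) w).1 0 = gather w.1 0 := by
    simp [cubeAntipode]
  have h1 : ∀ i : Fin n, gather (cubeAntipode (Equiv.swap 0 1) w).1 i.succ =
      -gather w.1 i.succ := by
    intro i
    have e : Equiv.swap (0 : Fin (n + 2)) 1 i.succ.succ = i.succ.succ :=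
      Equiv.swap_apply_of_ne_of_ne (Fin.succ_ne_zero _)
        (by simp [Fin.ext_iff])
    simp [cubeAntipode, e]
    ring
  refine Subtype.ext ?_
  simp only [toUnitSphere]
  rw [norm_toLp_congr (x := gather (cubeAntipode (Equiv.swap 0 1) w).1) (y := gather w.1)]
  · ext i
    refine Fin.cases ?_ (fun i => ?_) i
    · simp [sphereReflection, h0]
    · simp [sphereReflection, h1]
      ring
  · intro i
    refine Fin.cases ?_ (fun i => ?_) i
    · rw [h0]
    · rw [h1, abs_neg]

end SphereModel

/-! ### Replacing the antipode by an iterated reflection -/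

section Rotation

variable {n : ℕ}

/-- The rotation by `θ` in the coordinate planes spanned by `i` and `τ i`, oriented by the signs
`s`; coordinates of sign zero are kept. -/
noncomputable def planeRotation (τ : Fin (n + 1) → Fin (n + 1)) (s : Fin (n + 1) → ℝ) (θ : ℝ)
    (x : Fin (n + 1) → ℝ) (i : Fin (n + 1)) : ℝ :=
  x i + s i ^ 2 * (Real.cos θ - 1) * x i + s i * Real.sin θ * x (τ i)

/-- A pairing of some of the coordinates, with an orientation of each pair. -/
structure IsOrientedPairing (τ : Fin (n + 1) → Fin (n + 1)) (s : Fin (n + 1) → ℝ) : Prop where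
  invol : Function.Involutive τ
  neg : ∀ i, s (τ i) = -s i
  sq : ∀ i, s i = 0 ∨ s i ^ 2 = 1

theorem planeRotation_neg {τ : Fin (n + 1) → Fin (n + 1)} {s : Fin (n + 1) → ℝ}
    (h : IsOrientedPairing τ s) (θ : ℝ) (x : Fin (n + 1) → ℝ) :
    planeRotation τ s θ (planeRotation τ s (-θ) x) = x := by
  funext i
  simp only [planeRotation, h.neg, h.invol i, Real.cos_neg, Real.sin_neg]
  rcases h.sq i with hs | hs
  · simp [hs]
  · have := Real.sin_sq_add_cos_sq θ
    have e : (-s i) ^ 2 = 1 := by rw [neg_sq, hs]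
    rw [e, hs]
    linear_combination x i * this + Real.sin θ ^ 2 * x i * hs

theorem sum_sq_planeRotation {τ : Fin (n + 1) → Fin (n + 1)} {s : Fin (n + 1) → ℝ}
    (h : IsOrientedPairing τ s) (θ : ℝ) (x : Fin (n + 1) → ℝ) :
    ∑ i, planeRotation τ s θ x i ^ 2 = ∑ i, x i ^ 2 := by
  -- The change of the `i`-th squared coordinate. It is odd under the pairing `τ`, so the changes
  -- cancel in the sum.
  let D : Fin (n + 1) → ℝ := fun i => s i ^ 2 * Real.sin θ ^ 2 * (x (τ i) ^ 2 - x i ^ 2) +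
    2 * s i * Real.sin θ * Real.cos θ * x i * x (τ i)
  have h1 : ∀ i, planeRotation τ s θ x i ^ 2 = x i ^ 2 + D i := by
    intro i
    simp only [planeRotation, D]
    rcases h.sq i with hs | hs
    · simp [hs]
    · have := Real.sin_sq_add_cos_sq θ
      rw [hs]
      linear_combination x i ^ 2 * this + Real.sin θ ^ 2 * x (τ i) ^ 2 * hs
  have h2 : ∑ i, D i = ∑ i, D (τ i) := (Equiv.sum_comp (h.invol.toPerm) D).symm
  have h3 : ∀ i, D (τ i) = -D i := by
    intro i
    simp only [D, h.neg, h.invol i]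
    ring
  simp only [h3, Finset.sum_neg_distrib] at h2
  simp only [h1, Finset.sum_add_distrib]
  linarith

/-- `planeRotation` on the unit sphere. -/
noncomputable def sphereRotation {τ : Fin (n + 1) → Fin (n + 1)} {s : Fin (n + 1) → ℝ}
    (h : IsOrientedPairing τ s) (θ : ℝ) (x : UnitSphere n) : UnitSphere n :=
  ⟨WithLp.toLp 2 (planeRotation τ s θ x.1), by
    have hx : ‖x.1‖ = 1 := mem_sphere_zero_iff_norm.mp x.2
    refine mem_sphere_zero_iff_norm.mpr (Eq.trans ?_ hx)
    rw [EuclideanSpace.norm_eq, EuclideanSpace.norm_eq]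
    congr 1
    simpa using sum_sq_planeRotation h θ x.1⟩

theorem sphereRotation_neg {τ : Fin (n + 1) → Fin (n + 1)} {s : Fin (n + 1) → ℝ}
    (h : IsOrientedPairing τ s) (θ : ℝ) (x : UnitSphere n) :
    sphereRotation h θ (sphereRotation h (-θ) x) = x := by
  refine Subtype.ext ?_
  ext i
  exact congrFun (planeRotation_neg h θ x.1) i

theorem continuous_sphereRotation {τ : Fin (n + 1) → Fin (n + 1)} {s : Fin (n + 1) → ℝ}
    (h : IsOrientedPairing τ s) :
    Continuous fun p : UnitSphere n × ℝ => sphereRotation h p.2 p.1 := by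
  refine Continuous.subtype_mk ((PiLp.continuous_toLp 2 _).comp (continuous_pi fun i => ?_)) _
  have hc : ∀ j, Continuous fun p : UnitSphere n × ℝ => p.1.1 j := fun j => by fun_prop
  unfold planeRotation
  have := hc i
  have := hc (τ i)
  fun_prop

/-- The rotation by half a turn can be removed from the monodromy. -/
theorem nonempty_homeomorph_rotation {τ : Fin (n + 1) → Fin (n + 1)} {s : Fin (n + 1) → ℝ}
    (h : IsOrientedPairing τ s) (f : UnitSphere n → UnitSphere n) :
    Nonempty (MappingTorus f ≃ₜ MappingTorus fun x => sphereRotation h Real.pi (f x)) := by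
  have e := MappingTorus.isotopy (fun t x => sphereRotation h (Real.pi * t) x)
    (fun t x => sphereRotation h (-(Real.pi * t)) x)
    ((continuous_sphereRotation h).comp (f := fun p : UnitSphere n × unitInterval =>
      (p.1, Real.pi * (p.2 : ℝ))) (by fun_prop))
    ((continuous_sphereRotation h).comp (f := fun p : UnitSphere n × unitInterval =>
      (p.1, -(Real.pi * (p.2 : ℝ)))) (by fun_prop))
    (fun t x => sphereRotation_neg h _ x)
    (fun t x => by
      have := sphereRotation_neg h (-(Real.pi * t)) x
      rwa [neg_neg] at this)
    (fun x => by
      refine Subtype.ext ?_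
      ext i
      simp [sphereRotation, planeRotation]) f
  have hf : (fun x => sphereRotation h Real.pi (f x)) =
      fun x => sphereRotation h (Real.pi * ((1 : unitInterval) : ℝ)) (f x) := by
    simp
  rw [hf]
  exact ⟨e⟩

/-- Partners for pairing consecutive coordinates, starting at `0` if `n` is odd and at `1`
otherwise. -/
def pairPartner (n : ℕ) (i : Fin (n + 1)) : Fin (n + 1) :=
  if n % 2 = 0 ∧ i.1 = 0 then i
  else if h : (i.1 + n) % 2 = 1 ∧ i.1 + 1 < n + 1 then ⟨i.1 + 1, h.2⟩
  else ⟨i.1 - 1, by omega⟩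

/-- The orientations that go with `pairPartner`. -/
def pairSign (n : ℕ) (i : Fin (n + 1)) : ℝ :=
  if n % 2 = 0 ∧ i.1 = 0 then 0 else if (i.1 + n) % 2 = 1 then 1 else -1

theorem isOrientedPairing_pair (n : ℕ) :
    IsOrientedPairing (pairPartner n) (pairSign n) where
  invol i := by
    obtain ⟨i, hi⟩ := i
    ext
    unfold pairPartner
    grind
  neg i := by
    obtain ⟨i, hi⟩ := i
    unfold pairPartner pairSign
    grind
  sq i := by
    unfold pairSign
    split_ifs <;> simp

theorem sphereReflection_involutive (n : ℕ) : Function.Involutive (sphereReflection n) := by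
  intro x
  refine Subtype.ext ?_
  ext i
  by_cases h : i = 0 <;> simp [sphereReflection, h]

theorem sphereReflection_neg (n : ℕ) (x : UnitSphere n) :
    sphereReflection n (-x) = -sphereReflection n x := by
  refine Subtype.ext ?_
  ext i
  by_cases h : i = 0 <;> simp [sphereReflection, h]

/-- A half turn negates the paired coordinates. For odd `n` these are all of them; for even `n`
coordinate `0` is left alone, and the reflection accounts for its sign. -/
theorem sphereRotation_pi_pair (n : ℕ) (x : UnitSphere n) :
    sphereRotation (isOrientedPairing_pair n) Real.pi x =
      -(sphereReflection n)^[n + 1] x := by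
  refine Subtype.ext ?_
  rcases Nat.even_or_odd (n + 1) with hn | hn
  · rw [(sphereReflection_involutive n).iterate_even hn]
    have hn' : n % 2 = 1 := by obtain ⟨m, hm⟩ := hn; omega
    ext i
    have hs : pairSign n i ^ 2 = 1 := by
      simp only [pairSign, hn', one_ne_zero, false_and, if_false]
      split_ifs <;> simp
    simp only [sphereRotation, planeRotation, hs, Real.cos_pi, Real.sin_pi]
    simp
    ring
  · rw [(sphereReflection_involutive n).iterate_odd hn]
    have hn' : n % 2 = 0 := by obtain ⟨m, hm⟩ := hn; omega
    ext i
    by_cases hi : i = 0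
    · simp [sphereRotation, planeRotation, pairSign, hn', sphereReflection, hi]
    · have hi' : i.1 ≠ 0 := fun h => hi (Fin.ext h)
      have hs : pairSign n i ^ 2 = 1 := by
        simp only [pairSign, hi', and_false, if_false]
        split_ifs <;> simp
      simp [sphereRotation, planeRotation, hs, sphereReflection, hi]
      ring

/-- After composition with the half turn the two minus signs cancel, and `n + 1` reflections join
the `a` already present. -/
theorem nonempty_homeomorph_neg_iterate (n a : ℕ) :
    Nonempty (MappingTorus (fun x => -(sphereReflection n)^[a] x) ≃ₜ
      MappingTorus (sphereReflection n)^[n + 1 + a]) := by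
  have key : ∀ m x, (sphereReflection n)^[m] (-x) = -(sphereReflection n)^[m] x := by
    intro m
    induction m with
    | zero => intro x; rfl
    | succ m ih => intro x; rw [Function.iterate_succ_apply, sphereReflection_neg, ih,
        Function.iterate_succ_apply]
  obtain ⟨e⟩ := nonempty_homeomorph_rotation (isOrientedPairing_pair n)
    (fun x => -(sphereReflection n)^[a] x)
  have : (fun x => sphereRotation (isOrientedPairing_pair n) Real.pi
      (-(sphereReflection n)^[a] x)) = (sphereReflection n)^[n + 1 + a] := by
    funext x
    rw [sphereRotation_pi_pair, key, neg_neg, ← Function.iterate_add_apply]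
  rw [this] at e
  exact ⟨e⟩

end Rotation

/-- The three cross-polytopal cylinders glued with `a` transpositions. -/
theorem nonempty_homeomorph_crossTorus_iterate (n a : ℕ) (ha : a = 0 ∨ a = 1) :
    Nonempty (polyhedron (crossTorus (if a = 0 then 1 else Equiv.swap (0 : Fin (n + 2)) 1)) ≃ₜ
      MappingTorus (sphereReflection n)^[n + 1 + a]) := by
  obtain ⟨e⟩ := nonempty_homeomorph_crossTorus (if a = 0 then 1 else Equiv.swap (0 : Fin (n + 2)) 1)
  obtain ⟨e'⟩ := nonempty_homeomorph_neg_iterate n a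
  refine ⟨e.symm.trans ((MappingTorus.conj (cubeSphereHomeomorph n) ?_).trans e')⟩
  intro w
  change toUnitSphere _ = -(sphereReflection n)^[a] (toUnitSphere w)
  rcases ha with rfl | rfl
  · exact toUnitSphere_antipode w
  · exact toUnitSphere_antipode_swap w

/-! ### Colour-preserving moves: edge subdivision and the path move -/

section Moves

variable {V : Type*} [Fintype V] [DecidableEq V] {d : ℕ}

theorem mem_stellar_pair {K : Set (Finset V)} {x y b : V} {t : Finset V} :
    t ∈ stellar K {x, y} b ↔ ¬ (x ∈ t ∧ y ∈ t) ∧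
      (t ∈ K ∨ b ∈ t ∧ insert x (insert y (t.erase b)) ∈ K) := by
  have : t \ {b} ∪ {x, y} = insert x (insert y (t.erase b)) := by
    ext v
    simp only [Finset.mem_union, Finset.mem_sdiff, Finset.mem_singleton, Finset.mem_insert,
      Finset.mem_erase]
    tauto
  simp only [stellar, bistellar, Set.mem_ofPred_eq, Finset.insert_subset_iff,
    Finset.singleton_subset_iff, this]

theorem mem_bistellar_pair {K : Set (Finset V)} {x y p r : V} {t : Finset V} :
    t ∈ bistellar K {x, y} {p, r} ↔ ¬ (x ∈ t ∧ y ∈ t) ∧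
      (t ∈ K ∨ (p ∈ t ∧ r ∈ t) ∧ insert x (insert y ((t.erase p).erase r)) ∈ K) := by
  have : t \ {p, r} ∪ {x, y} = insert x (insert y ((t.erase p).erase r)) := by
    ext v
    simp only [Finset.mem_union, Finset.mem_sdiff, Finset.mem_singleton, Finset.mem_insert,
      Finset.mem_erase]
    tauto
  simp only [bistellar, Set.mem_ofPred_eq, Finset.insert_subset_iff,
    Finset.singleton_subset_iff, this]

/-- The faces of `K` are rainbow for the colouring `κ`. -/
def IsRainbow (K : Set (Finset V)) (κ : V → Fin d) : Prop :=
  ∀ s ∈ K, ∀ x ∈ s, ∀ y ∈ s, κ x = κ y → x = y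

/-- `K` has two disjoint faces with `d` vertices. -/
def HasDisjointFacets (K : Set (Finset V)) (d : ℕ) : Prop :=
  ∃ s ∈ K, ∃ t ∈ K, Disjoint s t ∧ s.card = d ∧ t.card = d

/-- The vertices `p, q, r, s` form a path in the link of `w`, coloured alternately, whose inner
vertices have no other neighbours in the colours of the path; the disc `w * pqrs` can then be
retriangulated with one more vertex. -/
structure HasAlternatingPath (K : Set (Finset V)) (κ : V → Fin d) (w p q r s : V) : Prop where
  mem : {w, q, r} ∈ K
  ends : {p, s} ∉ K
  color_pr : κ p = κ r
  color_qs : κ q = κ s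
  ne_wq : κ w ≠ κ q
  ne_wr : κ w ≠ κ r
  ne_qr : κ q ≠ κ r
  ne_pr : p ≠ r
  ne_qs : q ≠ s
  link_q : ∀ t ∈ K, w ∈ t → q ∈ t → p ∉ t → r ∉ t → insert p t ∈ K ∧ insert r t ∈ K
  link_r : ∀ t ∈ K, w ∈ t → r ∈ t → q ∉ t → s ∉ t → insert q t ∈ K ∧ insert s t ∈ K

/-- At most one of two disjoint facets contains the edge; there the endpoint `x` is exchanged for
the new vertex. -/
theorem hasDisjointFacets_stellar {K : Set (Finset V)} (hK : IsLowerSet K) {x y b : V}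
    (hxb : x ≠ b) (hbK : {b} ∉ K) (h : HasDisjointFacets K d) :
    HasDisjointFacets (stellar K {x, y} b) d := by
  have hb : ∀ t ∈ K, b ∉ t := fun t ht hbt =>
    hbK (hK (show ({b} : Finset V) ≤ t by simpa using hbt) ht)
  have key : ∀ s ∈ K, x ∈ s → y ∈ s → insert b (s.erase x) ∈ stellar K {x, y} b := by
    intro s hs hx hy
    refine mem_stellar_pair.mpr ⟨by simp [hxb], Or.inr ⟨by simp, hK (fun v hv => ?_) hs⟩⟩
    simp only [Finset.mem_insert, Finset.mem_erase] at hv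
    grind
  have key2 : ∀ s ∈ K, ¬ (x ∈ s ∧ y ∈ s) → s ∈ stellar K {x, y} b := fun s hs hn =>
    mem_stellar_pair.mpr ⟨hn, Or.inl hs⟩
  have hcard : ∀ s ∈ K, x ∈ s → (insert b (s.erase x)).card = s.card := by
    intro s hs hx
    rw [Finset.card_insert_of_notMem fun h => hb s hs (Finset.mem_of_mem_erase h),
      Finset.card_erase_add_one hx]
  obtain ⟨s, hs, t, ht, hst, hsc, htc⟩ := h
  have hst' := Finset.disjoint_left.mp hst
  by_cases h1 : x ∈ s ∧ y ∈ s
  · refine ⟨_, key s hs h1.1 h1.2, t, key2 t ht fun h => hst' h1.1 h.1, ?_,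
      (hcard s hs h1.1).trans hsc, htc⟩
    rw [Finset.disjoint_left]
    intro v hv hvt
    simp only [Finset.mem_insert, Finset.mem_erase] at hv
    rcases hv with rfl | hv
    · exact hb t ht hvt
    · exact hst' hv.2 hvt
  · by_cases h2 : x ∈ t ∧ y ∈ t
    · refine ⟨s, key2 s hs h1, _, key t ht h2.1 h2.2, ?_, hsc, (hcard t ht h2.1).trans htc⟩
      rw [Finset.disjoint_left]
      intro v hvs hv
      simp only [Finset.mem_insert, Finset.mem_erase] at hv
      rcases hv with rfl | hv
      · exact hb s hs hvs
      · exact hst' hvs hv.2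
    · exact ⟨s, key2 s hs h1, t, key2 t ht h2, hst, hsc, htc⟩

theorem singleton_mem_stellar {K : Set (Finset V)} {x y b v : V} (hxy : x ≠ y)
    (hv : {v} ∈ K) : {v} ∈ stellar K {x, y} b :=
  mem_stellar_pair.mpr ⟨by
    simp only [Finset.mem_singleton]
    rintro ⟨rfl, h⟩
    exact hxy h.symm, Or.inl hv⟩

theorem singleton_new_mem_stellar {K : Set (Finset V)} {x y b : V} (hxb : x ≠ b)
    (hxy : {x, y} ∈ K) : {b} ∈ stellar K {x, y} b :=
  mem_stellar_pair.mpr ⟨by simp [hxb], Or.inr ⟨by simp, by simpa using hxy⟩⟩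

variable {K : Set (Finset V)} {κ : V → Fin d}

/-- Replacing an edge `u v` by a path `u b a v` keeps a complex rainbow. -/
theorem isRainbow_subdivideEdge (hK : IsLowerSet K) (hκ : IsRainbow K κ) {u v a b : V}
    (ha : {a} ∉ K) (hb : {b} ∉ K) (hab : a ≠ b) (hu : {u} ∈ K) (hv : {v} ∈ K)
    (hκa : κ a = κ u) (hκb : κ b = κ v) (huv : κ u ≠ κ v) :
    IsRainbow (stellar (stellar K {u, v} b) {b, v} a) κ := by
  have ha' : ∀ t ∈ K, a ∉ t := fun t ht h => ha (hK (by simpa using h) ht)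
  have hb' : ∀ t ∈ K, b ∉ t := fun t ht h => hb (hK (by simpa using h) ht)
  have hua : u ≠ a := by rintro rfl; exact ha hu
  have hva : v ≠ a := by rintro rfl; exact ha hv
  have hub : u ≠ b := by rintro rfl; exact hb hu
  have hvb : v ≠ b := by rintro rfl; exact hb hv
  intro t ht x hx y hy hxy
  rw [mem_stellar_pair, mem_stellar_pair, mem_stellar_pair] at ht
  obtain ⟨hbv, ⟨huv', ht | ⟨hbt, ht⟩⟩ | ⟨hat, huv', ht | ⟨hbt, ht⟩⟩⟩ := ht
  · exact hκ t ht x hx y hy hxy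
  · have := hκ _ ht
    grind
  · exact absurd (by simp) (hb' _ ht)
  · have := hκ _ ht
    grind

/-- Each inner vertex of `u b a v` was created by subdividing an edge, so its link is suspended
between its two neighbours on the path. The edge `uv` itself is gone, and `w` can be any third
vertex of a face through it. -/
theorem hasAlternatingPath_subdivideEdge (hK : IsLowerSet K) {u v w a b : V}
    (ha : {a} ∉ K) (hb : {b} ∉ K) (huvw : {u, v, w} ∈ K)
    (hκa : κ a = κ u) (hκb : κ b = κ v) (huv : κ u ≠ κ v) (hwu : κ w ≠ κ u) (hwv : κ w ≠ κ v) :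
    HasAlternatingPath (stellar (stellar K {u, v} b) {b, v} a) κ w u b a v := by
  have ha' : ∀ t ∈ K, a ∉ t := fun t ht h => ha (hK (by simpa using h) ht)
  have hb' : ∀ t ∈ K, b ∉ t := fun t ht h => hb (hK (by simpa using h) ht)
  have hau := ha' _ huvw
  have hbu := hb' _ huvw
  simp only [Finset.mem_insert, Finset.mem_singleton, not_or] at hau hbu
  have huv' : u ≠ v := fun h => huv (congrArg κ h)
  have huw' : w ≠ u := fun h => hwu (congrArg κ h)
  have hvw' : w ≠ v := fun h => hwv (congrArg κ h)
  refine ⟨?_, ?_, hκa.symm, hκb, hκb ▸ hwv, hκa ▸ hwu, ?_, Ne.symm hau.1, hbu.2.1, ?_, ?_⟩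
  · refine mem_stellar_pair.mpr ⟨by grind, Or.inr ⟨by simp, ?_⟩⟩
    refine mem_stellar_pair.mpr ⟨by grind, Or.inr ⟨by simp, hK ?_ huvw⟩⟩
    intro x hx
    grind (ematch := 20) (gen := 30)
  · intro h
    rw [mem_stellar_pair] at h
    obtain ⟨-, h | ⟨h, -⟩⟩ := h
    · rw [mem_stellar_pair] at h
      exact h.1 (by simp)
    · grind
  · rw [hκa, hκb]; exact huv.symm
  · intro t ht hwt hbt hut hat
    simp only [mem_stellar_pair] at ht ⊢
    obtain ⟨hbv, ⟨-, ht | ⟨-, ht⟩⟩ | ⟨hat', -⟩⟩ := ht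
    · exact absurd hbt (hb' t ht)
    · refine ⟨⟨by grind, Or.inl ⟨by grind, Or.inr ⟨by grind, hK ?_ ht⟩⟩⟩,
        ⟨by grind, Or.inr ⟨by grind, ⟨by grind, Or.inr ⟨by grind, hK ?_ ht⟩⟩⟩⟩⟩ <;>
      · intro x hx
        grind
    · exact absurd hat' hat
  · intro t ht hwt hat hbt hvt
    simp only [mem_stellar_pair] at ht ⊢
    obtain ⟨-, ⟨-, ht | ⟨hbt', -⟩⟩ | ⟨-, huv'', ht | ⟨-, ht⟩⟩⟩ := ht
    · exact absurd hat (ha' t ht)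
    · exact absurd hbt' hbt
    · exact absurd (by simp) (hb' _ ht)
    · refine ⟨⟨by grind, Or.inr ⟨by grind, ⟨by grind, Or.inr ⟨by grind, hK ?_ ht⟩⟩⟩⟩,
        ⟨by grind, Or.inr ⟨by grind, ⟨by grind, Or.inr ⟨by grind, hK ?_ ht⟩⟩⟩⟩⟩ <;>
      · intro x hx
        grind

/-- The retriangulation of the disc spanned by an alternating path with one new vertex `z`. -/
def pathMove (K : Set (Finset V)) (w p q r s z : V) : Set (Finset V) :=
  stellar (bistellar (bistellar K {w, q} {p, r}) {w, r} {p, s}) {p, r} z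

variable {w p q r s z : V}

namespace HasAlternatingPath

theorem ne_all (h : HasAlternatingPath K κ w p q r s) :
    w ≠ p ∧ w ≠ q ∧ w ≠ r ∧ w ≠ s ∧ p ≠ q ∧ p ≠ r ∧ p ≠ s ∧ q ≠ r ∧ q ≠ s ∧ r ≠ s := by
  obtain ⟨-, -, h1, h2, h3, h4, h5, h6, h7, -, -⟩ := h
  refine ⟨?_, ?_, ?_, ?_, ?_, h6, ?_, ?_, h7, ?_⟩ <;> rintro rfl <;> simp_all

theorem mem_wqp (h : HasAlternatingPath K κ w p q r s) (hK : IsLowerSet K) :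
    {p, w, q} ∈ K := by
  obtain ⟨h1, h2, h3, h4, h5, h6, h7, h8, h9, h10⟩ := h.ne_all
  refine (h.link_q {w, q} (hK ?_ h.mem) (by simp) (by simp) ?_ ?_).1
  · intro x hx; grind
  · grind
  · grind

theorem first_not_subset (h : HasAlternatingPath K κ w p q r s) (hκ : IsRainbow K κ) :
    ∀ t ∈ K, ¬ ({p, r} : Finset V) ⊆ t := by
  intro t ht hs
  exact h.ne_pr (hκ t ht p (hs (by simp)) r (hs (by simp)) h.color_pr)

theorem first_link (h : HasAlternatingPath K κ w p q r s) :
    ∀ t ∈ K, {w, q} ⊆ t → Disjoint t {p, r} →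
      ∀ b ∈ ({p, r} : Finset V), t ∪ ({p, r} : Finset V).erase b ∈ K := by
  intro t ht hwq hd b hb
  simp only [Finset.insert_subset_iff, Finset.singleton_subset_iff] at hwq
  have hp : p ∉ t := fun hp => Finset.disjoint_left.mp hd hp (by simp)
  have hr : r ∉ t := fun hr => Finset.disjoint_left.mp hd hr (by simp)
  have := h.link_q t ht hwq.1 hwq.2 hp hr
  have hne := h.ne_pr
  simp only [Finset.mem_insert, Finset.mem_singleton] at hb
  rcases hb with rfl | rfl
  · convert this.2 using 1
    ext x; grind
  · convert this.1 using 1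
    ext x; grind

theorem isLowerSet_first (h : HasAlternatingPath K κ w p q r s) (hK : IsLowerSet K) :
    IsLowerSet (bistellar K {w, q} {p, r}) := by
  obtain ⟨h1, h2, h3, h4, h5, h6, h7, h8, h9, h10⟩ := h.ne_all
  exact isLowerSet_bistellar hK h.first_link (by simp [*, Ne.symm])

/-- Old faces are excluded by `ends`. A new face comes from a face of `K` through `q`, which cannot
also contain `s`, of the same colour. -/
theorem second_not_subset (h : HasAlternatingPath K κ w p q r s) (hK : IsLowerSet K)
    (hκ : IsRainbow K κ) :
    ∀ t ∈ bistellar K {w, q} {p, r}, ¬ ({p, s} : Finset V) ⊆ t := by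
  obtain ⟨h1, h2, h3, h4, h5, h6, h7, h8, h9, h10⟩ := h.ne_all
  intro t ht hs
  rw [mem_bistellar_pair] at ht
  rcases ht with ⟨-, ht | ⟨-, ht⟩⟩
  · exact h.ends (hK hs ht)
  · have : s ∈ t := hs (by simp)
    exact h.ne_qs (hκ _ ht q (by simp) s (by grind) h.color_qs)

/-- The first flip trades `q` for `p` in the link of `wr`: the extension by `s` is an old face,
while the extension by `p` is a new face coming from the old extension by `q`. -/
theorem second_link (h : HasAlternatingPath K κ w p q r s) (hK : IsLowerSet K) :
    ∀ t ∈ bistellar K {w, q} {p, r}, {w, r} ⊆ t → Disjoint t {p, s} →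
      ∀ b ∈ ({p, s} : Finset V),
        t ∪ ({p, s} : Finset V).erase b ∈ bistellar K {w, q} {p, r} := by
  obtain ⟨h1, h2, h3, h4, h5, h6, h7, h8, h9, h10⟩ := h.ne_all
  intro t ht hwr hd b hb
  simp only [Finset.insert_subset_iff, Finset.singleton_subset_iff] at hwr
  have hp : p ∉ t := fun hp => Finset.disjoint_left.mp hd hp (by simp)
  have hs : s ∉ t := fun hs => Finset.disjoint_left.mp hd hs (by simp)
  rw [mem_bistellar_pair] at ht ⊢
  rcases ht with ⟨hwq, ht | ⟨⟨hp', -⟩, -⟩⟩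
  · have hq : q ∉ t := fun hq => hwq ⟨hwr.1, hq⟩
    have hl := h.link_r t ht hwr.1 hwr.2 hq hs
    simp only [Finset.mem_insert, Finset.mem_singleton] at hb
    refine ⟨by grind, ?_⟩
    rcases hb with rfl | rfl
    · left
      refine hK ?_ hl.2
      intro x hx
      grind
    · right
      refine ⟨by grind, hK ?_ hl.1⟩
      intro x hx
      grind
  · exact absurd hp' hp

theorem isLowerSet_second (h : HasAlternatingPath K κ w p q r s) (hK : IsLowerSet K) :
    IsLowerSet (bistellar (bistellar K {w, q} {p, r}) {w, r} {p, s}) := by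
  obtain ⟨h1, h2, h3, h4, h5, h6, h7, h8, h9, h10⟩ := h.ne_all
  exact isLowerSet_bistellar (h.isLowerSet_first hK) (h.second_link hK) (by simp [*, Ne.symm])

theorem new_ne (h : HasAlternatingPath K κ w p q r s) (hK : IsLowerSet K) (hz : {z} ∉ K) :
    z ≠ w ∧ z ≠ p ∧ z ≠ q ∧ z ≠ r := by
  have h1 := h.mem
  have h2 := h.mem_wqp hK
  refine ⟨?_, ?_, ?_, ?_⟩ <;> rintro rfl <;> refine hz (hK ?_ ‹_›) <;> intro x hx <;> grind

theorem new_notMem (h : HasAlternatingPath K κ w p q r s) (hz : {z} ∉ K) :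
    {z} ∉ bistellar (bistellar K {w, q} {p, r}) {w, r} {p, s} := by
  obtain ⟨h1, h2, h3, h4, h5, h6, h7, h8, h9, h10⟩ := h.ne_all
  intro hm
  rw [mem_bistellar_pair, mem_bistellar_pair] at hm
  grind

theorem isLowerSet_pathMove (h : HasAlternatingPath K κ w p q r s) (hK : IsLowerSet K)
    (hz : {z} ∉ K) : IsLowerSet (pathMove K w p q r s z) := by
  obtain ⟨-, h2, -, h4⟩ := h.new_ne hK hz
  exact isLowerSet_stellar (h.isLowerSet_second hK) (by simp [h2, h4])

theorem nonempty_homeomorph_pathMove (h : HasAlternatingPath K κ w p q r s)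
    (hK : IsLowerSet K) (hκ : IsRainbow K κ) (hz : {z} ∉ K) :
    Nonempty (polyhedron K ≃ₜ polyhedron (pathMove K w p q r s z)) := by
  obtain ⟨h1, h2, h3, h4, h5, h6, h7, h8, h9, h10⟩ := h.ne_all
  obtain ⟨-, e2, -, e4⟩ := h.new_ne hK hz
  obtain ⟨f⟩ := nonempty_homeomorph_bistellar hK (A := {w, q}) (B := {p, r}) (by simp) (by simp)
    (by simp [*, Ne.symm]) (h.first_not_subset hκ) h.first_link
  obtain ⟨g⟩ := nonempty_homeomorph_bistellar (h.isLowerSet_first hK) (A := {w, r})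
    (B := {p, s}) (by simp) (by simp)
    (by simp [*, Ne.symm]) (h.second_not_subset hK hκ) (h.second_link hK)
  obtain ⟨k⟩ := nonempty_homeomorph_stellar (h.isLowerSet_second hK) (A := {p, r}) (b := z)
    (by simp) (by simp [e2, e4]) (h.new_notMem hz)
  exact ⟨(f.trans g).trans k⟩

/-- Both flips delete only faces through `w`, and the subdivided edge `pr` lies in no face of `K`.
-/
theorem mem_pathMove (h : HasAlternatingPath K κ w p q r s) (hκ : IsRainbow K κ)
    {t : Finset V} (ht : t ∈ K) (hwt : w ∉ t) : t ∈ pathMove K w p q r s z := by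
  refine mem_stellar_pair.mpr ⟨fun hpr => ?_, Or.inl (mem_bistellar_pair.mpr
    ⟨fun h => hwt h.1, Or.inl (mem_bistellar_pair.mpr ⟨fun h => hwt h.1, Or.inl ht⟩)⟩)⟩
  exact h.ne_pr (hκ t ht p hpr.1 r hpr.2 h.color_pr)

theorem singleton_mem_pathMove (h : HasAlternatingPath K κ w p q r s) {v : V} (hv : {v} ∈ K) :
    {v} ∈ pathMove K w p q r s z := by
  obtain ⟨h1, h2, h3, h4, h5, h6, h7, h8, h9, h10⟩ := h.ne_all
  refine mem_stellar_pair.mpr ⟨by grind, Or.inl (mem_bistellar_pair.mpr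
    ⟨by grind, Or.inl (mem_bistellar_pair.mpr ⟨by grind, Or.inl hv⟩)⟩)⟩

theorem singleton_new_mem_pathMove (h : HasAlternatingPath K κ w p q r s) (hK : IsLowerSet K)
    (hz : {z} ∉ K) : {z} ∈ pathMove K w p q r s z := by
  obtain ⟨h1, h2, h3, h4, h5, h6, h7, h8, h9, h10⟩ := h.ne_all
  obtain ⟨-, e2, -, e4⟩ := h.new_ne hK hz
  refine singleton_new_mem_stellar (Ne.symm e2) (mem_bistellar_pair.mpr ⟨by grind, Or.inl
    (mem_bistellar_pair.mpr ⟨by grind, Or.inr ⟨by simp, hK ?_ h.mem⟩⟩)⟩)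
  intro x hx
  grind

/-- The disc ends up with the triangles `wps`, `zps`, `zpq`, `zqr`, `zrs`, each with all three of
its colours. The remaining vertices of a face are checked inside a face of `K` enlarged by `link_q`
or `link_r`. -/
theorem isRainbow_pathMove (h : HasAlternatingPath K κ w p q r s) (hK : IsLowerSet K)
    (hκ : IsRainbow K κ) (hz : {z} ∉ K) (hκz : κ z = κ w) :
    IsRainbow (pathMove K w p q r s z) κ := by
  obtain ⟨h1, h2, h3, h4, h5, h6, h7, h8, h9, h10⟩ := h.ne_all
  obtain ⟨e1, e2, e3, e4⟩ := h.new_ne hK hz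
  have cpr := h.color_pr
  intro t ht x hx y hy hxy
  rw [pathMove, mem_stellar_pair] at ht
  obtain ⟨hpr, ht | ⟨hzt, ht⟩⟩ := ht
  · rw [mem_bistellar_pair, mem_bistellar_pair] at ht
    obtain ⟨hwr, ⟨hwq, ht | ⟨hpr', -⟩⟩ | ⟨hps, ht⟩⟩ := ht
    · exact hκ t ht x hx y hy hxy
    · exact absurd hpr' hpr
    · rw [mem_bistellar_pair] at ht
      obtain ⟨hwq, ht | ⟨hpr', -⟩⟩ := ht
      · have hU := (h.link_r _ ht (by grind) (by grind) (by grind) (by grind)).2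
        have := hκ _ hU
        grind
      · grind
  · rw [mem_bistellar_pair, mem_bistellar_pair] at ht
    obtain ⟨hwr, ⟨hwq, ht | ⟨hpr', ht⟩⟩ | ⟨hps, ht⟩⟩ := ht
    · exact absurd (hκ _ ht p (by simp) r (by simp) cpr) h6
    · have hU := h.link_q _ ht (by grind) (by grind) (by grind) (by grind)
      have c1 := hκ _ hU.1
      have c2 := hκ _ hU.2
      by_cases hp : p ∈ t
      · grind
      · grind (ematch := 20) (gen := 30)
    · rw [mem_bistellar_pair] at ht
      obtain ⟨hwq, ht | ⟨hpr', -⟩⟩ := ht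
      · have hU := (h.link_r _ ht (by grind) (by grind) (by grind) (by grind)).2
        have := hκ _ hU
        grind
      · grind

end HasAlternatingPath

end Moves

/-! ### Repairing two monochromatic edges -/

section Twisted

variable {V : Type*} [Fintype V] [DecidableEq V] {d : ℕ}

/-- A complex that is rainbow up to the two edges `x₁z₁` and `x₂z₂`, which span an empty
quadrangle `x₁x₂z₂z₁` whose other diagonals are missing. -/
structure IsTwistedRainbow (K : Set (Finset V)) (κ : V → Fin d) (w x₁ z₁ x₂ z₂ : V) : Prop where
  mem : {w, z₂, z₁} ∈ K
  edge₁ : {x₁, z₁} ∈ K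
  edge₂ : {x₂, z₂} ∈ K
  nonedge₁ : ∀ t ∈ K, x₁ ∈ t → z₂ ∉ t
  nonedge₂ : ∀ t ∈ K, x₂ ∈ t → z₁ ∉ t
  rainbow : ∀ t ∈ K, ∀ x ∈ t, ∀ y ∈ t, κ x = κ y →
    x = y ∨ (x = x₁ ∧ y = z₁) ∨ (x = z₁ ∧ y = x₁) ∨ (x = x₂ ∧ y = z₂) ∨ (x = z₂ ∧ y = x₂)
  ne₁ : x₁ ≠ z₁
  ne₂ : x₂ ≠ z₂
  color₁ : κ x₁ = κ z₁
  color₂ : κ x₂ = κ z₂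
  ne_color : κ z₂ ≠ κ z₁
  ne_color₁ : κ w ≠ κ z₁
  ne_color₂ : κ w ≠ κ z₂
  link₁ : ∀ t ∈ K, x₁ ∈ t → z₁ ∈ t → ∀ y ∈ t, κ y ≠ κ x₂
  link₂ : ∀ t ∈ K, x₂ ∈ t → z₂ ∈ t → ∀ y ∈ t, κ y ≠ κ x₁
  link_z₂ : ∀ t ∈ K, w ∈ t → z₂ ∈ t →
    (z₁ ∉ t → insert x₂ t ∈ K) ∧ (x₂ ∉ t → insert z₁ t ∈ K)
  link_z₁ : ∀ t ∈ K, w ∈ t → z₁ ∈ t →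
    (z₂ ∉ t → insert x₁ t ∈ K) ∧ (x₁ ∉ t → insert z₂ t ∈ K)

theorem IsTwistedRainbow.mapFaces {K : Set (Finset V)} {κ : V → Fin d} {w x₁ z₁ x₂ z₂ : V}
    (h : IsTwistedRainbow K κ w x₁ z₁ x₂ z₂) {W : Type*} [DecidableEq W] (f : V ↪ W)
    {κ' : W → Fin d} (hκ : ∀ v, κ' (f v) = κ v) :
    IsTwistedRainbow (mapFaces f K) κ' (f w) (f x₁) (f z₁) (f x₂) (f z₂) where
  mem := ⟨_, h.mem, by simp⟩
  edge₁ := ⟨_, h.edge₁, by simp⟩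
  edge₂ := ⟨_, h.edge₂, by simp⟩
  nonedge₁ := by
    rintro _ ⟨t, ht, rfl⟩ h1
    simpa using h.nonedge₁ t ht (by simpa using h1)
  nonedge₂ := by
    rintro _ ⟨t, ht, rfl⟩ h1
    simpa using h.nonedge₂ t ht (by simpa using h1)
  rainbow := by
    rintro _ ⟨t, ht, rfl⟩ _ hx _ hy hxy
    obtain ⟨x, hx', rfl⟩ := Finset.mem_map.mp hx
    obtain ⟨y, hy', rfl⟩ := Finset.mem_map.mp hy
    simpa using h.rainbow t ht x hx' y hy' (by simpa [hκ] using hxy)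
  ne₁ := by simpa using h.ne₁
  ne₂ := by simpa using h.ne₂
  color₁ := by simpa [hκ] using h.color₁
  color₂ := by simpa [hκ] using h.color₂
  ne_color := by simpa [hκ] using h.ne_color
  ne_color₁ := by simpa [hκ] using h.ne_color₁
  ne_color₂ := by simpa [hκ] using h.ne_color₂
  link₁ := by
    rintro _ ⟨t, ht, rfl⟩ h1 h2 _ hy
    obtain ⟨y, hy', rfl⟩ := Finset.mem_map.mp hy
    simpa [hκ] using h.link₁ t ht (by simpa using h1) (by simpa using h2) y hy'
  link₂ := by
    rintro _ ⟨t, ht, rfl⟩ h1 h2 _ hy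
    obtain ⟨y, hy', rfl⟩ := Finset.mem_map.mp hy
    simpa [hκ] using h.link₂ t ht (by simpa using h1) (by simpa using h2) y hy'
  link_z₂ := by
    rintro _ ⟨t, ht, rfl⟩ h1 h2
    obtain ⟨a, b⟩ := h.link_z₂ t ht (by simpa using h1) (by simpa using h2)
    exact ⟨fun h3 => ⟨_, a (by simpa using h3), by simp⟩,
      fun h3 => ⟨_, b (by simpa using h3), by simp⟩⟩
  link_z₁ := by
    rintro _ ⟨t, ht, rfl⟩ h1 h2
    obtain ⟨a, b⟩ := h.link_z₁ t ht (by simpa using h1) (by simpa using h2)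
    exact ⟨fun h3 => ⟨_, a (by simpa using h3), by simp⟩,
      fun h3 => ⟨_, b (by simpa using h3), by simp⟩⟩

variable {K : Set (Finset V)} {κ : V → Fin d} {w x₁ z₁ x₂ z₂ u v : V}

/-- Subdividing the two bad edges makes the complex rainbow. -/
theorem IsTwistedRainbow.isRainbow (h : IsTwistedRainbow K κ w x₁ z₁ x₂ z₂) (hK : IsLowerSet K)
    (hu : {u} ∉ K) (hv : {v} ∉ K) (hκu : κ u = κ x₂) (hκv : κ v = κ x₁) :
    IsRainbow (stellar (stellar K {x₁, z₁} u) {x₂, z₂} v) κ := by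
  have hu' : ∀ t ∈ K, u ∉ t := fun t ht h => hu (hK (by simpa using h) ht)
  have hv' : ∀ t ∈ K, v ∉ t := fun t ht h => hv (hK (by simpa using h) ht)
  have a1 := hu' _ h.edge₁
  have a2 := hu' _ h.edge₂
  have b1 := hv' _ h.edge₁
  have b2 := hv' _ h.edge₂
  simp only [Finset.mem_insert, Finset.mem_singleton, not_or] at a1 a2 b1 b2
  intro t ht x hx y hy hxy
  rw [mem_stellar_pair, mem_stellar_pair, mem_stellar_pair] at ht
  obtain ⟨h2, ⟨h1, ht | ⟨hut, ht⟩⟩ | ⟨hvt, h1, ht | ⟨hut, ht⟩⟩⟩ := ht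
  · have := h.rainbow t ht x hx y hy hxy
    grind
  · have r := h.rainbow _ ht
    have l := h.link₁ _ ht (by simp) (by simp)
    have n1 := h.nonedge₁ _ ht (by simp)
    have key : ∀ x ∈ t, x ≠ u → x ∈ insert x₁ (insert z₁ (t.erase u)) := by
      intro x hx hxu
      simp [hx, hxu]
    by_cases hxu : x = u
    · by_cases hyu : y = u
      · rw [hxu, hyu]
      · exact absurd (by rw [← hxy, hxu, hκu]) (l y (key y hy hyu))
    · by_cases hyu : y = u
      · exact absurd (by rw [hxy, hyu, hκu]) (l x (key x hx hxu))
      · have := r x (key x hx hxu) y (key y hy hyu) hxy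
        grind
  · have r := h.rainbow _ ht
    have l := h.link₂ _ ht (by simp) (by simp)
    have key : ∀ x ∈ t, x ≠ v → x ∈ insert x₂ (insert z₂ (t.erase v)) := by
      intro x hx hxu
      simp [hx, hxu]
    have n1 : x₁ ∉ insert x₂ (insert z₂ (t.erase v)) := fun hm => l _ hm rfl
    by_cases hxu : x = v
    · by_cases hyu : y = v
      · rw [hxu, hyu]
      · exact absurd (by rw [← hxy, hxu, hκv]) (l y (key y hy hyu))
    · by_cases hyu : y = v
      · exact absurd (by rw [hxy, hyu, hκv]) (l x (key x hx hxu))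
      · have := r x (key x hx hxu) y (key y hy hyu) hxy
        grind
  -- A face subdivided twice would come from one containing both bad edges, hence the missing
  -- diagonal `x₂z₁`.
  · exact absurd (by simp) (h.nonedge₂ _ ht (by simp [Ne.symm a2.1]))

/-- The link of `wz₂` is suspended between `x₂` and `z₁`, and subdivision puts `v` in place of `x₂`;
likewise `u` replaces `x₁` at `z₁`. Since each new vertex takes the colour of the other bad edge, `v
z₂ z₁ u` alternates. -/
theorem IsTwistedRainbow.hasAlternatingPath (h : IsTwistedRainbow K κ w x₁ z₁ x₂ z₂)
    (hK : IsLowerSet K) (hu : {u} ∉ K) (hv : {v} ∉ K) (huv : u ≠ v) (hκu : κ u = κ x₂)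
    (hκv : κ v = κ x₁) :
    HasAlternatingPath (stellar (stellar K {x₁, z₁} u) {x₂, z₂} v) κ w v z₂ z₁ u := by
  have hu' : ∀ t ∈ K, u ∉ t := fun t ht h => hu (hK (by simpa using h) ht)
  have hv' : ∀ t ∈ K, v ∉ t := fun t ht h => hv (hK (by simpa using h) ht)
  have a1 := hu' _ h.edge₁
  have a2 := hu' _ h.edge₂
  have b1 := hv' _ h.edge₁
  have b2 := hv' _ h.edge₂
  have b3 := hv' _ h.mem
  have a3 := hu' _ h.mem
  simp only [Finset.mem_insert, Finset.mem_singleton, not_or] at a1 a2 b1 b2 a3 b3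
  have c1 : x₁ ≠ z₂ := fun e => h.nonedge₁ _ h.edge₁ (by simp) (by simp [e])
  have c2 : x₂ ≠ z₁ := fun e => h.nonedge₂ _ h.edge₂ (by simp) (by simp [e])
  have c3 : z₁ ≠ z₂ := fun e => h.ne_color (congrArg κ e.symm)
  have c4 : x₁ ≠ x₂ := fun e => h.ne_color (by rw [← h.color₁, ← h.color₂, e])
  have c5 : w ≠ x₁ := fun e => h.ne_color₁ (by rw [e, h.color₁])
  have c6 : w ≠ x₂ := fun e => h.ne_color₂ (by rw [e, h.color₂])
  have d1 := h.ne₁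
  have d2 := h.ne₂
  refine ⟨?_, ?_, hκv.trans h.color₁, (hκu.trans h.color₂).symm, h.ne_color₂, h.ne_color₁,
    h.ne_color, b1.2, Ne.symm a2.2, ?_, ?_⟩
  · exact mem_stellar_pair.mpr ⟨by grind, Or.inl (mem_stellar_pair.mpr ⟨by grind, Or.inl h.mem⟩)⟩
  · intro hm
    rw [mem_stellar_pair, mem_stellar_pair, mem_stellar_pair] at hm
    obtain ⟨-, ⟨-, hm | ⟨-, hm⟩⟩ | ⟨-, -, hm | ⟨-, hm⟩⟩⟩ := hm
    · exact hu' _ hm (by simp)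
    · exact hv' _ hm (by simp [huv.symm])
    · exact hu' _ hm (by simp [huv])
    · exact h.nonedge₁ _ hm (by simp) (by simp [Ne.symm a2.2])
  · intro t ht hwt hz2 hvt hz1
    rw [mem_stellar_pair, mem_stellar_pair] at ht
    obtain ⟨hxz2, ⟨hxz1, ht | ⟨hut, ht⟩⟩ | ⟨hvt', -⟩⟩ := ht
    · have hx2 : x₂ ∉ t := fun hx => hxz2 ⟨hx, hz2⟩
      have hx1 : x₁ ∉ t := fun hx => h.nonedge₁ t ht hx hz2
      obtain ⟨e1, e2⟩ := h.link_z₂ t ht hwt hz2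
      constructor
      · refine mem_stellar_pair.mpr ⟨by grind, Or.inr ⟨by simp, mem_stellar_pair.mpr
          ⟨by grind, Or.inl (hK ?_ (e1 hz1))⟩⟩⟩
        intro x hx
        grind
      · exact mem_stellar_pair.mpr ⟨by grind, Or.inl (mem_stellar_pair.mpr
          ⟨by grind, Or.inl (e2 hx2)⟩)⟩
    · exact absurd (by simp [hz2, Ne.symm a2.2]) (h.nonedge₁ _ ht (by simp))
    · exact absurd hvt' hvt
  · intro t ht hwt hz1 hz2 hut
    rw [mem_stellar_pair, mem_stellar_pair, mem_stellar_pair] at ht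
    obtain ⟨hxz2, ⟨hxz1, ht | ⟨hut', -⟩⟩ | ⟨hvt, -, ht | ⟨hut', -⟩⟩⟩ := ht
    · have hx1 : x₁ ∉ t := fun hx => hxz1 ⟨hx, hz1⟩
      have hx2 : x₂ ∉ t := fun hx => h.nonedge₂ t ht hx hz1
      obtain ⟨e1, e2⟩ := h.link_z₁ t ht hwt hz1
      constructor
      · exact mem_stellar_pair.mpr ⟨by grind, Or.inl (mem_stellar_pair.mpr
          ⟨by grind, Or.inl (e2 hx1)⟩)⟩
      · refine mem_stellar_pair.mpr ⟨by grind, Or.inl (mem_stellar_pair.mpr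
          ⟨by grind, Or.inr ⟨by simp, hK ?_ (e1 hz2)⟩⟩)⟩
        intro x hx
        grind
    · exact absurd hut' hut
    · exact absurd (by simp [hz1, Ne.symm b1.2]) (h.nonedge₂ _ ht (by simp))
    · grind

end Twisted

/-! ### Faces and colours of the glued cylinders -/

section CrossTorusColors

variable {m : ℕ}

theorem IsCylinderFace.of_zero_two {d : ℕ} {σ : Equiv.Perm (Fin d)} {t : Finset (Fin 3 × Fin d)}
    (ht : t ∈ crossTorus σ) {i j : Fin d} (hi : (0, i) ∈ t) (hj : (2, j) ∈ t) :
    IsCylinderFace σ 2 t := by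
  obtain ⟨c, h⟩ := ht
  have h1 := h.level _ hi
  have h2 := h.level _ hj
  fin_cases c
  · simp at h2
  · simp at h1
  · exact h

theorem singleton_mem_crossTorus (σ : Equiv.Perm (Fin (m + 2))) (v : Fin 3 × Fin (m + 2)) :
    {v} ∈ crossTorus σ := by
  obtain ⟨c, i⟩ := v
  obtain ⟨j, hj⟩ := exists_ne i
  refine ⟨c, ⟨?_, ?_, ⟨j, by simp [hj]⟩, ⟨i, by simp⟩⟩⟩
  · rintro p hp
    simp only [Finset.mem_singleton] at hp
    simp [hp]
  · simp

/-- Complementary choices between levels 0 and 1, singling out index `0`. Both choices use both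
levels, so neither is a removed facet. -/
theorem hasDisjointFacets_crossTorus (σ : Equiv.Perm (Fin (m + 2))) :
    HasDisjointFacets (crossTorus σ) (m + 2) := by
  have key : ∀ f : Fin (m + 2) → Fin 3, (∀ i, f i = 0 ∨ f i = 1) → (∃ i, f i = 0) →
      (∃ i, f i = 1) → Finset.univ.image (fun i => (f i, i)) ∈ crossTorus σ := by
    rintro f hf ⟨i, hi⟩ ⟨j, hj⟩
    refine ⟨0, ⟨?_, ?_, ⟨j, ?_⟩, ⟨i, ?_⟩⟩⟩
    · intro p hp
      simp only [Finset.mem_image, Finset.mem_univ, true_and] at hp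
      obtain ⟨k, rfl⟩ := hp
      exact hf k
    · intro k hk hk'
      simp [glue] at hk hk'
      rw [hk] at hk'
      exact zero_ne_one hk'
    · simp [hj]
    · simp [hi]
  have hcard : ∀ f : Fin (m + 2) → Fin 3,
      (Finset.univ.image (fun i => (f i, i))).card = m + 2 := by
    intro f
    rw [Finset.card_image_of_injective _ fun i j h => (Prod.mk.inj h).2]
    simp
  refine ⟨_, key (fun i => if i = 0 then 0 else 1) ?_ ⟨0, by simp⟩ ⟨1, by simp⟩, _,
    key (fun i => if i = 0 then 1 else 0) ?_ ⟨1, by simp⟩ ⟨0, by simp⟩, ?_, hcard _, hcard _⟩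
  · intro i
    by_cases h : i = 0 <;> simp [h]
  · intro i
    by_cases h : i = 0 <;> simp [h]
  · rw [Finset.disjoint_left]
    rintro ⟨c, i⟩ h1 h2
    simp only [Finset.mem_image, Finset.mem_univ, true_and, Prod.mk.injEq, exists_eq_right]
      at h1 h2
    rw [← h2] at h1
    by_cases h : i = 0 <;> simp [h] at h1

theorem isRainbow_crossTorus (d : ℕ) :
    IsRainbow (crossTorus (1 : Equiv.Perm (Fin d))) Prod.snd := by
  rintro t ⟨c, h⟩ ⟨a, i⟩ hx ⟨b, j⟩ hy hxy
  simp only at hxy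
  subst hxy
  have hg : glue (1 : Equiv.Perm (Fin d)) c i = i := by
    unfold glue
    split_ifs <;> rfl
  have hap := h.antipodal i
  rw [hg] at hap
  rcases h.level _ hx with rfl | h1 <;> rcases h.level _ hy with h2 | h2 <;> simp only at *
  · rw [h2]
  · subst h2
    exact absurd hy (hap hx)
  · subst h1 h2
    exact absurd hx (hap hy)
  · rw [h1, h2]

/-- In the twisted cylinder `(2, 0)` is antipodal to `(0, 1)` and `(2, 1)` to `(0, 0)`, so equal
colours are joined only along `(0, 0)(2, 0)` and `(0, 1)(2, 1)`. A face containing one of these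
edges omits both vertices of the other. -/
theorem isTwistedRainbow_crossTorus (m : ℕ) :
    IsTwistedRainbow (crossTorus (Equiv.swap (0 : Fin (m + 3)) 1)) Prod.snd
      (0, 2) (0, 0) (2, 0) (0, 1) (2, 1) := by
  have n02 : (2 : Fin (m + 3)) ≠ 0 := by
    simp [Fin.ext_iff, Nat.mod_eq_of_lt (show 2 < m + 3 by omega)]
  have n12 : (2 : Fin (m + 3)) ≠ 1 := by
    simp [Fin.ext_iff, Nat.mod_eq_of_lt (show 2 < m + 3 by omega)]
  have n01 : (1 : Fin (m + 3)) ≠ 0 := by simp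
  have g0 : glue (Equiv.swap (0 : Fin (m + 3)) 1) 2 0 = 1 := by simp [glue]
  have g1 : glue (Equiv.swap (0 : Fin (m + 3)) 1) 2 1 = 0 := by simp [glue]
  have g2 : ∀ i : Fin (m + 3), i ≠ 0 → i ≠ 1 →
      glue (Equiv.swap (0 : Fin (m + 3)) 1) 2 i = i := by
    intro i h0 h1
    simp [glue, Equiv.swap_apply_of_ne_of_ne h0 h1]
  have e3 : (2 : Fin 3) + 1 = 0 := rfl
  have ap : ∀ t : Finset (Fin 3 × Fin (m + 3)),
      IsCylinderFace (Equiv.swap (0 : Fin (m + 3)) 1) 2 t →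
      ((2, 0) ∈ t → (0, 1) ∉ t) ∧ ((2, 1) ∈ t → (0, 0) ∉ t) ∧ ((0, 2) ∈ t → (2, 2) ∉ t) := by
    intro t h
    refine ⟨fun h1 => ?_, fun h1 => ?_, fun h1 h2 => ?_⟩
    · have := h.antipodal 0 h1
      rwa [g0] at this
    · have := h.antipodal 1 h1
      rwa [g1] at this
    · have := h.antipodal 2 h2
      rw [g2 2 n02 n12] at this
      exact this h1
  have mk : ∀ t : Finset (Fin 3 × Fin (m + 3)), (∀ p ∈ t, p.1 = 2 ∨ p.1 = 0) →
      ((2, 0) ∈ t → (0, 1) ∉ t) → ((2, 1) ∈ t → (0, 0) ∉ t) →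
      (∀ i, i ≠ 0 → i ≠ 1 → (2, i) ∈ t → (0, i) ∉ t) → (∃ i, (2, i) ∉ t) → (∃ i, (0, i) ∉ t) →
      t ∈ crossTorus (Equiv.swap (0 : Fin (m + 3)) 1) := by
    intro t h1 h2 h3 h4 h5 h6
    refine ⟨2, ⟨h1, fun i hi => ?_, h5, h6⟩⟩
    rw [e3]
    by_cases i0 : i = 0
    · subst i0
      rw [g0]
      exact h2 hi
    · by_cases i1 : i = 1
      · subst i1
        rw [g1]
        exact h3 hi
      · rw [g2 i i0 i1]
        exact h4 i i0 i1 hi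
  have rest : ∀ t : Finset (Fin 3 × Fin (m + 3)),
      IsCylinderFace (Equiv.swap (0 : Fin (m + 3)) 1) 2 t →
      ∀ i, i ≠ 0 → i ≠ 1 → (2, i) ∈ t → (0, i) ∉ t := by
    intro t h i i0 i1 hi
    have := h.antipodal i hi
    rwa [g2 i i0 i1] at this
  have lev : ∀ t : Finset (Fin 3 × Fin (m + 3)),
      IsCylinderFace (Equiv.swap (0 : Fin (m + 3)) 1) 2 t → ∀ p ∈ t, p.1 = 2 ∨ p.1 = 0 :=
    fun t h => h.level
  refine ⟨?_, ?_, ?_, ?_, ?_, ?_, by simp, by simp, rfl, rfl, n01, n02, n12, ?_, ?_, ?_, ?_⟩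
  · refine mk _ (by simp) ?_ ?_ ?_ ⟨2, ?_⟩ ⟨0, ?_⟩ <;> simp [n02, n12, n02.symm, n12.symm]
    intro i h0 h1 h
    exact absurd h (by simp [h0, h1])
  · refine mk _ (by simp) ?_ ?_ ?_ ⟨1, ?_⟩ ⟨1, ?_⟩ <;> simp +contextual
  · refine mk _ (by simp) ?_ ?_ ?_ ⟨0, ?_⟩ ⟨0, ?_⟩ <;> simp +contextual
  · intro t ht h1 h2
    exact (ap t (IsCylinderFace.of_zero_two ht h1 h2)).2.1 h2 h1
  · intro t ht h1 h2
    exact (ap t (IsCylinderFace.of_zero_two ht h1 h2)).1 h2 h1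
  · have key : ∀ t ∈ crossTorus (Equiv.swap (0 : Fin (m + 3)) 1), ∀ i, (2, i) ∈ t →
        (0, i) ∈ t → i = 0 ∨ i = 1 := by
      intro t ht i h2 h0
      by_contra! hi
      exact rest t (IsCylinderFace.of_zero_two ht h0 h2) i hi.1 hi.2 h2 h0
    have key01 : ∀ t ∈ crossTorus (Equiv.swap (0 : Fin (m + 3)) 1), ∀ i, (0, i) ∈ t →
        (1, i) ∉ t := by
      rintro t ⟨c, h⟩ i h0 h1
      have l0 := h.level _ h0
      have l1 := h.level _ h1
      fin_cases c
      · exact h.antipodal i h0 (by simpa [glue] using h1)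
      · simp at l0
      · simp at l1
    have key12 : ∀ t ∈ crossTorus (Equiv.swap (0 : Fin (m + 3)) 1), ∀ i, (1, i) ∈ t →
        (2, i) ∉ t := by
      rintro t ⟨c, h⟩ i h0 h1
      have l0 := h.level _ h0
      have l1 := h.level _ h1
      fin_cases c
      · simp at l1
      · exact h.antipodal i h0 (by simpa [glue] using h1)
      · simp at l0
    rintro t ht ⟨a, i⟩ hx ⟨b, j⟩ hy hxy
    simp only at hxy
    subst hxy
    have k1 := key t ht i
    have k2 := key01 t ht i
    have k3 := key12 t ht i
    fin_cases a <;> fin_cases b <;> simp at hx hy ⊢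
    · exact k2 hx hy
    · exact k1 hy hx
    · exact k2 hy hx
    · exact k3 hx hy
    · exact k1 hx hy
    · exact k3 hy hx
  · rintro t ht h0 h2 ⟨c, i⟩ hy hi
    have h := IsCylinderFace.of_zero_two ht h0 h2
    simp only at hi
    subst hi
    rcases h.level _ hy with hc | hc
    · simp only at hc
      subst hc
      exact (ap t h).2.1 hy h0
    · simp only [e3] at hc
      subst hc
      exact (ap t h).1 h2 hy
  · rintro t ht h0 h2 ⟨c, i⟩ hy hi
    have h := IsCylinderFace.of_zero_two ht h0 h2
    simp only at hi
    subst hi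
    rcases h.level _ hy with hc | hc
    · simp only at hc
      subst hc
      exact (ap t h).1 hy h0
    · simp only [e3] at hc
      subst hc
      exact (ap t h).2.1 h2 hy
  · intro t ht hw h2
    have h := IsCylinderFace.of_zero_two ht hw h2
    have hl := lev t h
    have hr := rest t h
    obtain ⟨p1, p2, p3⟩ := ap t h
    constructor
    · intro h1
      refine mk _ (by simpa using hl) ?_ ?_ ?_ ⟨0, ?_⟩ ⟨0, ?_⟩
      · simp [h1]
      · simp [p2 h2]
      · intro i i0 i1
        simpa [i1] using hr i i0 i1
      · simpa using h1
      · simpa using p2 h2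
    · intro h1
      -- Adding `(2, 0)` does not complete level 2, because `(0, 2) ∈ t` excludes `(2, 2)`. The
      -- third index is needed here.
      refine mk _ (by simpa using hl) ?_ ?_ ?_ ⟨2, ?_⟩ ⟨0, ?_⟩
      · simp [h1]
      · simp [p2 h2]
      · intro i i0 i1
        simpa [i0] using hr i i0 i1
      · simpa [n02] using p3 hw
      · simpa using p2 h2
  · intro t ht hw h2
    have h := IsCylinderFace.of_zero_two ht hw h2
    have hl := lev t h
    have hr := rest t h
    obtain ⟨p1, p2, p3⟩ := ap t h
    constructor
    · intro h1
      refine mk _ (by simpa using hl) ?_ ?_ ?_ ⟨1, ?_⟩ ⟨1, ?_⟩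
      · simp [p1 h2]
      · simp [h1]
      · intro i i0 i1
        simpa [i0] using hr i i0 i1
      · simpa using h1
      · simpa using p1 h2
    · intro h1
      refine mk _ (by simpa using hl) ?_ ?_ ?_ ⟨2, ?_⟩ ⟨1, ?_⟩
      · simp [p1 h2]
      · simp [h1]
      · intro i i0 i1
        simpa [i1] using hr i i0 i1
      · simpa [n12] using p3 hw
      · simpa using p1 h2

end CrossTorusColors

/-! ### Counting vertices and assembling the triangulations -/

section Assembly

variable {d N : ℕ} {X : Type*} [TopologicalSpace X]

/-- A rainbow complex on all of `V` with two disjoint facets. -/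
structure IsRainbowModel {V : Type} [Fintype V] [DecidableEq V] (K : Set (Finset V))
    (κ : V → Fin d) : Prop where
  lower : IsLowerSet K
  vertex : ∀ v, {v} ∈ K
  rainbow : IsRainbow K κ
  facets : HasDisjointFacets K d

/-- `X` has a rainbow model with `N` vertices. -/
def HasRainbowModel (X : Type*) [TopologicalSpace X] (d N : ℕ) : Prop :=
  ∃ (V : Type) (_ : Fintype V) (_ : DecidableEq V) (K : Set (Finset V)) (κ : V → Fin d),
    Fintype.card V = N ∧ IsRainbowModel K κ ∧ Nonempty (polyhedron K ≃ₜ X)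

/-- `X` has a rainbow model with `N` vertices and an alternating path. -/
def HasPathModel (X : Type*) [TopologicalSpace X] (d N : ℕ) : Prop :=
  ∃ (V : Type) (_ : Fintype V) (_ : DecidableEq V) (K : Set (Finset V)) (κ : V → Fin d),
    Fintype.card V = N ∧ IsRainbowModel K κ ∧ Nonempty (polyhedron K ≃ₜ X) ∧
      ∃ w p q r s, HasAlternatingPath K κ w p q r s

/-- `X` has a balanced triangulation with `N` vertices. -/
def HasBalancedTriangulation (X : Type*) [TopologicalSpace X] (d N : ℕ) : Prop :=
  ∃ (V : Type) (_ : Fintype V) (_ : DecidableEq V) (K : Set (Finset V)) (κ : V → Fin d),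
    Fintype.card V = N ∧ IsLowerSet K ∧ (∀ v, {v} ∈ K) ∧ IsRainbow K κ ∧
      (∃ s ∈ K, s.card = d) ∧ Nonempty (polyhedron K ≃ₜ X)

theorem HasPathModel.hasRainbowModel (h : HasPathModel X d N) : HasRainbowModel X d N := by
  obtain ⟨V, i1, i2, K, κ, hN, hK, e, -⟩ := h
  exact ⟨V, i1, i2, K, κ, hN, hK, e⟩

theorem HasRainbowModel.hasBalancedTriangulation (h : HasRainbowModel X d N) :
    HasBalancedTriangulation X d N := by
  obtain ⟨V, i1, i2, K, κ, hN, hK, e⟩ := h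
  obtain ⟨s, hs, -, -, -, hsc, -⟩ := hK.facets
  exact ⟨V, i1, i2, K, κ, hN, hK.lower, hK.vertex, hK.rainbow, ⟨s, hs, hsc⟩, e⟩

section MapFaces

variable {V : Type} [Fintype V] [DecidableEq V] {W : Type} [Fintype W] [DecidableEq W]
  {K : Set (Finset V)} {κ : V → Fin d}

theorem IsRainbow.mapFaces (h : IsRainbow K κ) (f : V ↪ W) {κ' : W → Fin d}
    (hκ : ∀ v, κ' (f v) = κ v) : IsRainbow (mapFaces f K) κ' := by
  rintro _ ⟨t, ht, rfl⟩ _ hx _ hy hxy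
  obtain ⟨x, hx', rfl⟩ := Finset.mem_map.mp hx
  obtain ⟨y, hy', rfl⟩ := Finset.mem_map.mp hy
  rw [h t ht x hx' y hy' (by simpa [hκ] using hxy)]

theorem HasDisjointFacets.mapFaces (h : HasDisjointFacets K d) (f : V ↪ W) :
    HasDisjointFacets (mapFaces f K) d := by
  obtain ⟨s, hs, t, ht, hst, hsc, htc⟩ := h
  exact ⟨_, ⟨s, hs, rfl⟩, _, ⟨t, ht, rfl⟩, by simpa using hst, by simpa using hsc,
    by simpa using htc⟩

theorem singleton_mem_mapFaces {f : V ↪ W} {v : V} (hv : {v} ∈ K) : {f v} ∈ mapFaces f K :=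
  ⟨_, hv, by simp⟩

theorem singleton_notMem_mapFaces {f : V ↪ W} {w : W} (hw : ∀ v, f v ≠ w) :
    {w} ∉ mapFaces f K := by
  rintro ⟨s, -, hs⟩
  have : w ∈ s.map f := by simp [hs]
  obtain ⟨v, -, hv⟩ := Finset.mem_map.mp this
  exact hw v hv

end MapFaces

/-- Two stellar subdivisions with new vertices. -/
theorem isRainbowModel_stellar_stellar {V : Type} [Fintype V] [DecidableEq V]
    {K : Set (Finset V)} {κ : V → Fin d} {x y b x' y' a : V} (hK : IsLowerSet K)
    (hf : HasDisjointFacets K d) (hb : {b} ∉ K) (ha : {a} ∉ K) (hab : a ≠ b)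
    (hxy : {x, y} ∈ K) (hne : x ≠ y) (hne' : x' ≠ y') (hxy' : {x', y'} ∈ stellar K {x, y} b)
    (hv : ∀ v, v = a ∨ v = b ∨ {v} ∈ K)
    (hκ : IsRainbow (stellar (stellar K {x, y} b) {x', y'} a) κ) :
    IsRainbowModel (stellar (stellar K {x, y} b) {x', y'} a) κ ∧
      Nonempty (polyhedron K ≃ₜ polyhedron (stellar (stellar K {x, y} b) {x', y'} a)) := by
  have hbxy : b ∉ ({x, y} : Finset V) := fun h => hb (hK (by simpa using h) hxy)
  have hL := isLowerSet_stellar hK hbxy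
  have haL : {a} ∉ stellar K {x, y} b := by
    rw [mem_stellar_pair]
    rintro ⟨-, h | ⟨h, -⟩⟩
    · exact ha h
    · exact hab (Finset.mem_singleton.mp h).symm
  have haxy : a ∉ ({x', y'} : Finset V) := fun h => haL (hL (by simpa using h) hxy')
  have hxb : x ≠ b := by rintro rfl; simp at hbxy
  have hxa : x' ≠ a := by rintro rfl; simp at haxy
  refine ⟨⟨isLowerSet_stellar hL haxy, fun v => ?_, hκ,
    hasDisjointFacets_stellar hL hxa haL (hasDisjointFacets_stellar hK hxb hb hf)⟩, ?_⟩
  · rcases hv v with rfl | rfl | hv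
    · exact singleton_new_mem_stellar hxa hxy'
    · exact singleton_mem_stellar hne' (singleton_new_mem_stellar hxb hxy)
    · exact singleton_mem_stellar hne' (singleton_mem_stellar hne hv)
  · obtain ⟨e⟩ := nonempty_homeomorph_stellar hK (by simp) hbxy hb
    obtain ⟨e'⟩ := nonempty_homeomorph_stellar hL (by simp) haxy haL
    exact ⟨e.trans e'⟩

/-- Two vertices can be added to a rainbow model. -/
theorem HasRainbowModel.hasPathModel (hd : 3 ≤ d) (h : HasRainbowModel X d N) :
    HasPathModel X d (N + 2) := by
  obtain ⟨V, i1, i2, K, κ, hN, hK, ⟨e⟩⟩ := h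
  obtain ⟨T, hT, -, -, -, hTc, -⟩ := hK.facets
  obtain ⟨u, v, w, hu, hv, hw, huv, huw, hvw⟩ :=
    Finset.two_lt_card_iff.mp (show 2 < T.card by omega)
  have hc := hK.rainbow T hT
  have cuv : κ u ≠ κ v := fun h => huv (hc u hu v hv h)
  have cuw : κ w ≠ κ u := fun h => huw (hc u hu w hw h.symm)
  have cvw : κ w ≠ κ v := fun h => hvw (hc v hv w hw h.symm)
  have huvw : {u, v, w} ∈ K := hK.lower (fun x hx => by
    simp only [Finset.mem_insert, Finset.mem_singleton] at hx
    rcases hx with rfl | rfl | rfl <;> assumption) hT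
  have huv' : {u, v} ∈ K := hK.lower (fun x hx => by
    simp only [Finset.mem_insert, Finset.mem_singleton] at hx
    rcases hx with rfl | rfl <;> assumption) hT
  let f : V ↪ V ⊕ Fin 2 := Function.Embedding.inl
  -- The new vertex next to `u` is coloured like `v` and the one next to `v` like `u`.
  let κ' : V ⊕ Fin 2 → Fin d := Sum.elim κ ![κ v, κ u]
  have hfκ : ∀ v, κ' (f v) = κ v := fun _ => rfl
  have hb : {Sum.inr 0} ∉ mapFaces f K := singleton_notMem_mapFaces fun _ => Sum.inl_ne_inr
  have ha : {Sum.inr 1} ∉ mapFaces f K := singleton_notMem_mapFaces fun _ => Sum.inl_ne_inr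
  have hL := isLowerSet_mapFaces f hK.lower
  have hu' := singleton_mem_mapFaces (f := f) (hK.vertex u)
  have hv' := singleton_mem_mapFaces (f := f) (hK.vertex v)
  have huvf : {f u, f v} ∈ mapFaces f K := ⟨_, huv', by simp⟩
  obtain ⟨e1⟩ := nonempty_homeomorph_mapFaces f K
  have hpath : HasAlternatingPath _ κ' (f w) (f u) (Sum.inr 0) (Sum.inr 1) (f v) :=
    hasAlternatingPath_subdivideEdge (κ := κ') hL ha hb ⟨_, huvw, by simp⟩ rfl rfl cuv cuw cvw
  have hedge : {Sum.inr 0, f v} ∈ stellar (mapFaces f K) {f u, f v} (Sum.inr 0) := by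
    refine mem_stellar_pair.mpr ⟨?_, Or.inr ⟨by simp, hL ?_ huvf⟩⟩
    · simp [f, huv]
    · intro x hx
      simp only [Finset.mem_insert, Finset.mem_singleton, Finset.mem_erase] at hx ⊢
      tauto
  have hvert : ∀ x : V ⊕ Fin 2, x = Sum.inr 1 ∨ x = Sum.inr 0 ∨ {x} ∈ mapFaces f K := by
    rintro (v | i)
    · exact Or.inr (Or.inr (singleton_mem_mapFaces (f := f) (hK.vertex v)))
    · fin_cases i
      · exact Or.inr (Or.inl rfl)
      · exact Or.inl rfl
  obtain ⟨hmodel, ⟨e2⟩⟩ := isRainbowModel_stellar_stellar (κ := κ') (x := f u) (y := f v)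
    (b := Sum.inr 0) (x' := Sum.inr 0) (y' := f v) (a := Sum.inr 1) hL (hK.facets.mapFaces f) hb ha
    (by simp) huvf (by simpa using huv) Sum.inr_ne_inl hedge hvert
    (isRainbow_subdivideEdge hL (hK.rainbow.mapFaces f hfκ) ha hb (by simp) hu' hv' rfl rfl cuv)
  exact ⟨_, inferInstance, inferInstance, _, κ', by simp [hN], hmodel,
    ⟨(e1.trans e2).symm.trans e⟩, _, _, _, _, _, hpath⟩

/-- One vertex can be added to a rainbow model with an alternating path. -/
theorem HasPathModel.hasBalancedTriangulation_succ (h : HasPathModel X d N) :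
    HasBalancedTriangulation X d (N + 1) := by
  obtain ⟨V, i1, i2, K, κ, hN, hK, ⟨e⟩, w, p, q, r, s, hp⟩ := h
  let f : V ↪ V ⊕ Unit := Function.Embedding.inl
  let κ' : V ⊕ Unit → Fin d := Sum.elim κ fun _ => κ w
  have hfκ : ∀ v, κ' (f v) = κ v := fun _ => rfl
  have hz : {Sum.inr ()} ∉ mapFaces f K := singleton_notMem_mapFaces fun _ => Sum.inl_ne_inr
  have hL := isLowerSet_mapFaces f hK.lower
  have hR := hK.rainbow.mapFaces f hfκ
  have hp' : HasAlternatingPath (mapFaces f K) κ' (f w) (f p) (f q) (f r) (f s) := by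
    refine ⟨⟨_, hp.mem, by simp⟩, ?_, hp.color_pr, hp.color_qs, hp.ne_wq, hp.ne_wr, hp.ne_qr,
      by simpa using hp.ne_pr, by simpa using hp.ne_qs, ?_, ?_⟩
    · rintro ⟨t, ht, hts⟩
      refine hp.ends (hK.lower ?_ ht)
      intro x hx
      have : f x ∈ t.map f := by
        rw [hts]
        simpa using hx
      simpa using this
    · rintro _ ⟨t, ht, rfl⟩ h1 h2 h3 h4
      obtain ⟨a, b⟩ := hp.link_q t ht (by simpa using h1) (by simpa using h2)
        (by simpa using h3) (by simpa using h4)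
      exact ⟨⟨_, a, by simp⟩, ⟨_, b, by simp⟩⟩
    · rintro _ ⟨t, ht, rfl⟩ h1 h2 h3 h4
      obtain ⟨a, b⟩ := hp.link_r t ht (by simpa using h1) (by simpa using h2)
        (by simpa using h3) (by simpa using h4)
      exact ⟨⟨_, a, by simp⟩, ⟨_, b, by simp⟩⟩
  obtain ⟨e1⟩ := nonempty_homeomorph_mapFaces f K
  obtain ⟨e2⟩ := hp'.nonempty_homeomorph_pathMove hL hR hz
  refine ⟨_, inferInstance, inferInstance, _, κ', by simp [hN], hp'.isLowerSet_pathMove hL hz,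
    ?_, hp'.isRainbow_pathMove hL hR hz rfl, ?_, ⟨(e1.trans e2).symm.trans e⟩⟩
  · rintro (v | ⟨⟩)
    · exact hp'.singleton_mem_pathMove (singleton_mem_mapFaces (f := f) (hK.vertex v))
    · exact hp'.singleton_new_mem_pathMove hL hz
  · obtain ⟨s, hs, t, ht, hst, hsc, htc⟩ := hK.facets.mapFaces f
    -- Only faces through `w` can be lost, and `w` misses one of the two disjoint facets.
    by_cases hws : f w ∈ s
    · exact ⟨t, hp'.mem_pathMove hR ht (Finset.disjoint_left.mp hst hws), htc⟩
    · exact ⟨s, hp'.mem_pathMove hR hs hws, hsc⟩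

/-- Edge subdivisions supply pairs of vertices and a fresh path. The path move need not leave one,
so it is used once at most, as the last step for odd `k`. -/
theorem HasPathModel.hasBalancedTriangulation_add (hd : 3 ≤ d) (h : HasPathModel X d N) (k : ℕ) :
    HasBalancedTriangulation X d (N + k) := by
  have key : ∀ j, HasPathModel X d (N + 2 * j) := by
    intro j
    induction j with
    | zero => exact h
    | succ j ih => exact ih.hasRainbowModel.hasPathModel hd
  rcases Nat.even_or_odd' k with ⟨j, rfl | rfl⟩
  · exact (key j).hasRainbowModel.hasBalancedTriangulation
  · exact (key j).hasBalancedTriangulation_succ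

/-- The mapping tori of the iterated reflection have path models with `3d + 2` vertices. -/
theorem hasPathModel_mappingTorus (m a : ℕ) (ha : a = 0 ∨ a = 1) :
    HasPathModel (MappingTorus (sphereReflection (m + 1))^[m + 2 + a]) (m + 3)
      (3 * (m + 3) + 2) := by
  have e := nonempty_homeomorph_crossTorus_iterate (m + 1) a ha
  rcases ha with rfl | rfl
  · refine HasRainbowModel.hasPathModel (by omega) ⟨_, inferInstance, inferInstance, _, Prod.snd,
      by simp, ⟨isLowerSet_crossTorus _, singleton_mem_crossTorus _, isRainbow_crossTorus _,
        hasDisjointFacets_crossTorus _⟩, e⟩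
  · obtain ⟨e⟩ := e
    have ht := isTwistedRainbow_crossTorus m
    have hK := isLowerSet_crossTorus (Equiv.swap (0 : Fin (m + 3)) 1)
    let f : Fin 3 × Fin (m + 3) ↪ (Fin 3 × Fin (m + 3)) ⊕ Fin 2 := Function.Embedding.inl
    -- The vertex subdividing the edge of colour `0` gets colour `1`, and conversely.
    let κ' : (Fin 3 × Fin (m + 3)) ⊕ Fin 2 → Fin (m + 3) := Sum.elim Prod.snd ![1, 0]
    have ht' := ht.mapFaces f (κ' := κ') fun _ => rfl
    have hL := isLowerSet_mapFaces f hK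
    have hb : {Sum.inr 0} ∉ mapFaces f (crossTorus (Equiv.swap (0 : Fin (m + 3)) 1)) :=
      singleton_notMem_mapFaces fun _ => Sum.inl_ne_inr
    have ha : {Sum.inr 1} ∉ mapFaces f (crossTorus (Equiv.swap (0 : Fin (m + 3)) 1)) :=
      singleton_notMem_mapFaces fun _ => Sum.inl_ne_inr
    obtain ⟨e1⟩ := nonempty_homeomorph_mapFaces f (crossTorus (Equiv.swap (0 : Fin (m + 3)) 1))
    obtain ⟨hmodel, ⟨e2⟩⟩ := isRainbowModel_stellar_stellar (κ := κ') hL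
      ((hasDisjointFacets_crossTorus _).mapFaces f) hb ha (by simp) ht'.edge₁ ht'.ne₁ ht'.ne₂
      (mem_stellar_pair.mpr ⟨by simp, Or.inl ht'.edge₂⟩) (by
        rintro (v | i)
        · exact Or.inr (Or.inr (singleton_mem_mapFaces (f := f) (singleton_mem_crossTorus _ v)))
        · fin_cases i
          · exact Or.inr (Or.inl rfl)
          · exact Or.inl rfl)
      (ht'.isRainbow hL hb ha rfl rfl)
    exact ⟨_, inferInstance, inferInstance, _, κ', by simp, hmodel,
        ⟨(e1.trans e2).symm.trans e⟩, _, _, _, _, _,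
        ht'.hasAlternatingPath hL hb ha (by simp) rfl rfl⟩

/-- The colours bound the size of the faces, and the charts of `X` are pulled back along the
homeomorphism. Dropping the empty face loses no point, since the coordinates sum to `1`. -/
theorem HasBalancedTriangulation.exists_complex {n : ℕ}
    (h : HasBalancedTriangulation X (n + 1) N) (hX : IsLocallyEuclidean n X) :
    ∃ K : AbstractSimplicialComplex (Fin N),
      K.IsBalanced n ∧ K.IsSimplicialManifold n ∧ K.Triangulates X := by
  obtain ⟨V, i1, i2, K, κ, hN, hK, hv, hκ, ⟨s, hs, hsc⟩, ⟨e⟩⟩ := h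
  let g : V ≃ Fin N := Fintype.equivFinOfCardEq hN
  have hL := isLowerSet_mapFaces g.toEmbedding hK
  let L : AbstractSimplicialComplex (Fin N) :=
    { faces := {t | t ∈ mapFaces g.toEmbedding K ∧ t.Nonempty}
      isRelLowerSet_faces := fun t ht => ⟨ht.2, fun u hu hne => ⟨hL hu ht.1, hne⟩⟩
      singleton_mem := fun v => ⟨by
        have := singleton_mem_mapFaces (f := g.toEmbedding) (hv (g.symm v))
        simpa using this, by simp⟩ }
  have hreal : L.realization = polyhedron (mapFaces g.toEmbedding K) := by
    ext x
    constructor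
    · rintro ⟨hx, t, ht, htx⟩
      exact ⟨hx, t, ht.1, htx⟩
    · rintro ⟨hx, t, ht, htx⟩
      refine ⟨hx, t, ⟨ht, ?_⟩, htx⟩
      by_contra hne
      rw [Finset.not_nonempty_iff_eq_empty] at hne
      have h1 := hx.2
      simp [htx, hne] at h1
  have hR : IsRainbow (mapFaces g.toEmbedding K) (κ ∘ g.symm) := hκ.mapFaces _ fun v => by simp
  have hcol : ∀ t ∈ L.faces, Set.InjOn (κ ∘ g.symm) (t : Set (Fin N)) :=
    fun t ht x hx y hy hxy => hR t ht.1 x hx y hy hxy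
  have hdim : L.HasDim n := by
    refine ⟨⟨s.map g.toEmbedding, ⟨⟨s, hs, rfl⟩, ?_⟩, by simpa using hsc⟩, fun t ht => ?_⟩
    · rw [Finset.map_nonempty, ← Finset.card_pos]
      omega
    · have := Finset.card_le_card_of_injOn (t := Finset.univ) (κ ∘ g.symm)
        (fun _ _ => Finset.mem_coe.mpr (Finset.mem_univ _)) (hcol t ht)
      simpa using this
  obtain ⟨e1⟩ := nonempty_homeomorph_mapFaces g.toEmbedding K
  let E : L.realization ≃ₜ X := (Homeomorph.setCongr hreal).trans (e1.symm.trans e)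
  exact ⟨L, ⟨hdim, _, hcol⟩, ⟨hdim, inferInstance, inferInstance,
    hX.of_isOpenEmbedding E E.isOpenEmbedding⟩, ⟨E⟩⟩

theorem HasBalancedTriangulation.congr {Y : Type*} [TopologicalSpace Y]
    (h : HasBalancedTriangulation X d N) (e : X ≃ₜ Y) : HasBalancedTriangulation Y d N := by
  obtain ⟨V, i1, i2, K, κ, hN, hK, hv, hκ, hs, ⟨f⟩⟩ := h
  exact ⟨V, i1, i2, K, κ, hN, hK, hv, hκ, hs, ⟨f.trans e⟩⟩

end Assembly

/-- The reflection of the sphere as a homeomorphism. -/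
noncomputable def sphereReflectionHomeomorph (n : ℕ) : UnitSphere n ≃ₜ UnitSphere n := by
  have hc : Continuous (sphereReflection n) := by
    refine Continuous.subtype_mk ((PiLp.continuous_toLp 2 _).comp (continuous_pi fun i => ?_)) _
    split_ifs <;> fun_prop
  exact ⟨(sphereReflection_involutive n).toPerm, hc, hc⟩

theorem theorem6p9 (d k : ℕ) (hd : 3 ≤ d) (hk : 2 ≤ k) :
    (∃ K : AbstractSimplicialComplex (Fin (3 * d + k)),
      K.IsBalanced (d - 1) ∧ K.IsSimplicialManifold (d - 1) ∧
        K.Triangulates (UnitSphere (d - 2) × Circle)) ∧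
    (∃ K : AbstractSimplicialComplex (Fin (3 * d + k)),
      K.IsBalanced (d - 1) ∧ K.IsSimplicialManifold (d - 1) ∧
        K.Triangulates (NonorientableSphereBundle (d - 2))) := by
  obtain ⟨m, rfl⟩ := Nat.exists_eq_add_of_le' hd
  obtain ⟨j, rfl⟩ := Nat.exists_eq_add_of_le' hk
  have hN : 3 * (m + 3) + (j + 2) = 3 * (m + 3) + 2 + j := by omega
  rw [hN]
  have h1 : m + 3 - 1 = m + 1 + 1 := rfl
  have h2 : m + 3 - 2 = m + 1 := rfl
  rw [h1, h2]
  have key : ∀ a, a = 0 ∨ a = 1 → HasBalancedTriangulation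
      (MappingTorus (sphereReflection (m + 1))^[m + 2 + a]) (m + 3) (3 * (m + 3) + 2 + j) :=
    fun a ha => (hasPathModel_mappingTorus m a ha).hasBalancedTriangulation_add hd j
  have hinv := sphereReflection_involutive (m + 1)
  -- The monodromy depends only on the parity of `m + 2 + a`, so `a` is chosen to make it even here
  -- and odd for the nonorientable bundle.
  have even_case : HasBalancedTriangulation (MappingTorus (id : UnitSphere (m + 1) → _)) (m + 3)
      (3 * (m + 3) + 2 + j) := by
    rcases Nat.even_or_odd m with hm | hm
    · have := key 0 (Or.inl rfl)
      rwa [hinv.iterate_even (by rw [Nat.even_iff] at *; omega)] at this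
    · have := key 1 (Or.inr rfl)
      rwa [hinv.iterate_even (by rw [Nat.even_iff]; rw [Nat.odd_iff] at hm; omega)] at this
  have odd_case : HasBalancedTriangulation (NonorientableSphereBundle (m + 1)) (m + 3)
      (3 * (m + 3) + 2 + j) := by
    rcases Nat.even_or_odd m with hm | hm
    · have := key 1 (Or.inr rfl)
      rwa [hinv.iterate_odd (by rw [Nat.odd_iff]; rw [Nat.even_iff] at hm; omega)] at this
    · have := key 0 (Or.inl rfl)
      rwa [hinv.iterate_odd (by rw [Nat.odd_iff] at *; omega)] at this
  have hS := isLocallyEuclidean_unitSphere (m + 1)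
  constructor
  · have : T2Space (UnitSphere (m + 1)) :=
      (Topology.IsEmbedding.subtypeVal).t2Space
    obtain ⟨e⟩ := MappingTorus.nonempty_homeomorph_prod_circle (X := UnitSphere (m + 1))
    exact (even_case.congr e).exists_complex
      ((isLocallyEuclidean_mappingTorus hS (Homeomorph.refl _)).of_isOpenEmbedding e.symm
        e.symm.isOpenEmbedding)
  · exact odd_case.exists_complex
      (isLocallyEuclidean_mappingTorus hS (sphereReflectionHomeomorph (m + 1)))
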